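/- For an integer $m\ge 1$ write $m=2^{4\alpha+\beta}m'$ with $m'$ odd, $\alpha\ge 0$ an integer and $\beta\in\{0,1,2,3\}$, and let $\rho(m)=8\alpha+2^{\beta}$ be the Radon--Hurwitz function. Let $S^{m-1}$ be the round sphere of some radius $r>0$ in $\mathbb{R}^m$ with its induced Riemannian metric. A smooth vector field $X$ on (an open subset of) a Riemannian manifold $(M,g)$ is Killing if $L_Xg=0$; a Clifford--Killing space on $(M,g)$ is a nonzero finite-dimensional real vector space of (globally defined) Killing vector fields, each of constant length; $(M,g)$ has the Killing property if every point has a neighborhood on which there is an orthonormal frame consisting of Killing vector fields. (1) The maximal dimension of a Clifford--Killing space on $S^{m-1}$ equals $\rho(m)-1$ (where the maximal dimension is $0$ if there is no Clifford--Killing space). (2) Consequently, this maximal dimension equals $m-1>0$ if and only if $m\in\{2,4,8\}$; and a round sphere $S^{m-1}$ of positive dimension has the Killing property if and only if it is $S^1$, $S^3$ or $S^7$. -/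

import Mathlib

open scoped Manifold ContDiff Bundle

noncomputable section

/-- The Radon-Hurwitz function: if `m = 2 ^ (4 * α + β) * m'` with `m'` odd and `0 ≤ β ≤ 3`,
then `radonHurwitz m = 8 * α + 2 ^ β`. (The value at `m = 0` is irrelevant.) -/
def radonHurwitz (m : ℕ) : ℕ :=
  8 * (padicValNat 2 m / 4) + 2 ^ (padicValNat 2 m % 4)

section Riemannian

variable {n : ℕ} {M : Type*} [TopologicalSpace M] [ChartedSpace (EuclideanSpace ℝ (Fin n)) M]

/-- A (not necessarily continuous) vector field on the `n`-dimensional manifold `M`. -/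
abbrev VecField (n : ℕ) (M : Type*) [TopologicalSpace M]
    [ChartedSpace (EuclideanSpace ℝ (Fin n)) M] : Type _ :=
  (x : M) → TangentSpace (𝓡 n) x

/-- A smooth Riemannian metric on the `n`-dimensional smooth manifold `M`. -/
abbrev SmoothMetric (n : ℕ) (M : Type*) [TopologicalSpace M]
    [ChartedSpace (EuclideanSpace ℝ (Fin n)) M] [IsManifold (𝓡 n) ∞ M] : Type _ :=
  haveI : IsManifold (𝓡 n) 1 M := IsManifold.of_le (n := ∞) (by norm_cast)
  Bundle.ContMDiffRiemannianMetric (𝓡 n) ∞ (EuclideanSpace ℝ (Fin n))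
    (fun x : M => TangentSpace (𝓡 n) x)

variable [IsManifold (𝓡 n) ∞ M]

/-- The vector field `X` is smooth on the set `U`. -/
def IsSmoothOn (X : VecField n M) (U : Set M) : Prop :=
  ContMDiffOn (𝓡 n) (𝓡 n).tangent ∞
    (fun x => (⟨x, X x⟩ : TangentBundle (𝓡 n) M)) U

/-- The vector field `X` is a Killing vector field on the open set `U`: it is smooth there and
`L_X g = 0` on `U`, where
`(L_X g)(Y, Z) = X (g (Y, Z)) - g ([X, Y], Z) - g (Y, [X, Z])` for vector fields `Y`, `Z` that are
smooth on `U`. -/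
def IsKillingOn (g : SmoothMetric n M) (X : VecField n M) (U : Set M) : Prop :=
  IsSmoothOn X U ∧
  ∀ Y Z : VecField n M, IsSmoothOn Y U → IsSmoothOn Z U → ∀ x ∈ U,
    mvfderiv (𝓡 n) (fun y => g.inner y (Y y) (Z y)) x (X x)
      - g.inner x (VectorField.mlieBracket (𝓡 n) X Y x) (Z x)
      - g.inner x (Y x) (VectorField.mlieBracket (𝓡 n) X Z x) = 0

/-- A Killing vector field on the whole manifold. -/
def IsKilling (g : SmoothMetric n M) (X : VecField n M) : Prop :=
  IsKillingOn g X Set.univ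

/-- The vector field `X` has constant length. -/
def HasConstantLength (g : SmoothMetric n M) (X : VecField n M) : Prop :=
  ∃ c : ℝ, ∀ x : M, Real.sqrt (g.inner x (X x) (X x)) = c

/-- A Clifford-Killing space: a nonzero finite-dimensional real vector space of Killing vector
fields of constant length. -/
structure IsCliffordKilling (g : SmoothMetric n M) (V : Submodule ℝ (VecField n M)) : Prop where
  finiteDimensional : FiniteDimensional ℝ V
  ne_bot : V ≠ ⊥
  isKilling : ∀ X ∈ V, IsKilling g X
  constantLength : ∀ X ∈ V, HasConstantLength g X

/-- `l` is the maximal dimension of the Clifford-Killing spaces of `g`; this is `0` if there are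
none. -/
def IsMaxCliffordKillingDim (g : SmoothMetric n M) (l : ℕ) : Prop :=
  IsGreatest {d : ℕ | d = 0 ∨ ∃ V : Submodule ℝ (VecField n M),
    IsCliffordKilling g V ∧ Module.finrank ℝ V = d} l

/-- The Killing property: near every point there is an orthonormal frame (of `n = dim M` fields)
that consists of (local) Killing vector fields. -/
def HasKillingProperty (g : SmoothMetric n M) : Prop :=
  ∀ x : M, ∃ U : Set M, IsOpen U ∧ x ∈ U ∧ ∃ X : Fin n → VecField n M,
    (∀ i, IsKillingOn g (X i) U) ∧
    ∀ y ∈ U, ∀ i j, g.inner y (X i y) (X j y) = if i = j then 1 else 0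

end Riemannian

section Sphere

/-- The unit sphere `S^n` of `ℝ^(n+1)`, as a smooth manifold. -/
abbrev StdSphere (n : ℕ) : Type :=
  Metric.sphere (0 : EuclideanSpace ℝ (Fin (n + 1))) 1

/-- The differential at `x` of the inclusion of `S^n` in `ℝ^(n+1)`. -/
def sphereInclDeriv (n : ℕ) (x : StdSphere n) :
    TangentSpace (𝓡 n) x →L[ℝ] EuclideanSpace ℝ (Fin (n + 1)) :=
  mvfderiv (𝓡 n) (fun y : StdSphere n => (y : EuclideanSpace ℝ (Fin (n + 1)))) x

theorem sphereInclDeriv_injective (n : ℕ) (x : StdSphere n) :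
    Function.Injective (sphereInclDeriv n x) := by
  have := Fact.mk (@finrank_euclideanSpace_fin ℝ _ (n + 1))
  exact injective_mvfderiv_subtypeVal_sphere x

/-- The inner product on `T_x S^n` pulled back from `ℝ^(n+1)` along `y ↦ r • y`. -/
def roundInner (n : ℕ) (r : ℝ) (x : StdSphere n) :
    TangentSpace (𝓡 n) x →L[ℝ] TangentSpace (𝓡 n) x →L[ℝ] ℝ :=
  ((r • sphereInclDeriv n x).precomp ℝ).comp ((innerSL ℝ).comp (r • sphereInclDeriv n x))

theorem roundInner_apply (n : ℕ) (r : ℝ) (x : StdSphere n) (v w : TangentSpace (𝓡 n) x) :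
    roundInner n r x v w =
      inner ℝ (r • sphereInclDeriv n x v) (r • sphereInclDeriv n x w) := rfl

theorem roundInner_contMDiff (n : ℕ) (r : ℝ) :
    ContMDiff (𝓡 n) ((𝓡 n).prod 𝓘(ℝ, EuclideanSpace ℝ (Fin n) →L[ℝ]
        EuclideanSpace ℝ (Fin n) →L[ℝ] ℝ)) ∞
      (fun x : StdSphere n => Bundle.TotalSpace.mk'
        (EuclideanSpace ℝ (Fin n) →L[ℝ] EuclideanSpace ℝ (Fin n) →L[ℝ] ℝ)
        (E := fun x : StdSphere n => TangentSpace (𝓡 n) x →L[ℝ] TangentSpace (𝓡 n) x →L[ℝ] ℝ)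
        x (roundInner n r x)) := by
  have := Fact.mk (@finrank_euclideanSpace_fin ℝ _ (n + 1))
  intro x₀
  have hd : ContMDiffAt (𝓡 n) 𝓘(ℝ, EuclideanSpace ℝ (Fin n) →L[ℝ]
      EuclideanSpace ℝ (Fin (n + 1))) ∞
      (inTangentCoordinates (𝓡 n) 𝓘(ℝ, EuclideanSpace ℝ (Fin (n + 1))) id
        (fun y : StdSphere n => (y : EuclideanSpace ℝ (Fin (n + 1))))
        (fun y => sphereInclDeriv n y) x₀) x₀ :=
    ContMDiffAt.mfderiv_const (contMDiff_coe_sphere x₀) (m := ∞) (n := ∞) le_rfl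
  rw [Bundle.contMDiffAt_section]
  have key : ContMDiffAt (𝓡 n) 𝓘(ℝ, EuclideanSpace ℝ (Fin n) →L[ℝ]
        EuclideanSpace ℝ (Fin n) →L[ℝ] ℝ) ∞ (fun x : StdSphere n =>
      ((innerSL ℝ).bilinearComp
        (r • inTangentCoordinates (𝓡 n) 𝓘(ℝ, EuclideanSpace ℝ (Fin (n + 1))) id
        (fun y : StdSphere n => (y : EuclideanSpace ℝ (Fin (n + 1))))
        (fun y => sphereInclDeriv n y) x₀ x)
        (r • inTangentCoordinates (𝓡 n) 𝓘(ℝ, EuclideanSpace ℝ (Fin (n + 1))) id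
        (fun y : StdSphere n => (y : EuclideanSpace ℝ (Fin (n + 1))))
        (fun y => sphereInclDeriv n y) x₀ x) :
        EuclideanSpace ℝ (Fin n) →L[ℝ] EuclideanSpace ℝ (Fin n) →L[ℝ] ℝ)) x₀ := by
    have hF : ContDiff ℝ ∞ (fun D : EuclideanSpace ℝ (Fin n) →L[ℝ]
        EuclideanSpace ℝ (Fin (n + 1)) =>
        ((innerSL ℝ).bilinearComp (r • D) (r • D) :
          EuclideanSpace ℝ (Fin n) →L[ℝ] EuclideanSpace ℝ (Fin n) →L[ℝ] ℝ)) := by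
      rw [contDiff_clm_apply_iff]
      intro v
      rw [contDiff_clm_apply_iff]
      intro w
      simp only [ContinuousLinearMap.bilinearComp_apply, innerSL_apply_apply]
      exact ContDiff.inner ℝ
        ((contDiff_id.clm_apply contDiff_const).const_smul r)
        ((contDiff_id.clm_apply contDiff_const).const_smul r)
    exact hF.contMDiff.contMDiffAt.comp x₀ hd
  refine key.congr_of_eventuallyEq ?_
  filter_upwards [(trivializationAt (EuclideanSpace ℝ (Fin n))
    (TangentSpace (𝓡 n) : StdSphere n → Type _) x₀).open_baseSet.mem_nhds
      (FiberBundle.mem_baseSet_trivializationAt' x₀)] with x hx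
  ext v w
  rw [hom_trivializationAt_apply]
  dsimp only
  rw [inCoordinates_apply_eq₂ hx hx (by simp)]
  have h : ∀ u, inTangentCoordinates (𝓡 n) 𝓘(ℝ, EuclideanSpace ℝ (Fin (n + 1))) id
        (fun y : StdSphere n => (y : EuclideanSpace ℝ (Fin (n + 1))))
        (fun y => sphereInclDeriv n y) x₀ x u = sphereInclDeriv n x
        ((trivializationAt (EuclideanSpace ℝ (Fin n))
          (TangentSpace (𝓡 n) : StdSphere n → Type _) x₀).symm x u) := by
    intro u
    change (trivializationAt (EuclideanSpace ℝ (Fin (n + 1)))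
      (TangentSpace 𝓘(ℝ, EuclideanSpace ℝ (Fin (n + 1))))
      (x₀ : EuclideanSpace ℝ (Fin (n + 1)))).continuousLinearMapAt ℝ
        (x : EuclideanSpace ℝ (Fin (n + 1)))
        (sphereInclDeriv n x ((trivializationAt (EuclideanSpace ℝ (Fin n))
          (TangentSpace (𝓡 n) : StdSphere n → Type _) x₀).symmL ℝ x u)) = _
    rw [TangentBundle.continuousLinearMapAt_model_space]
    rw [Bundle.Trivialization.symmL_apply _ hx]
    rfl
  simp only [ContinuousLinearMap.bilinearComp_apply, innerSL_apply_apply, smul_apply, h]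
  simp [roundInner_apply]

/-- The metric of the round `n`-dimensional sphere of radius `r > 0` in `ℝ^(n+1)`, carried to the
unit sphere by the diffeomorphism `y ↦ r • y`. -/
def roundMetric (n : ℕ) (r : ℝ) (hr : 0 < r) : SmoothMetric n (StdSphere n) where
  inner := roundInner n r
  symm x v w := by
    rw [roundInner_apply, roundInner_apply, real_inner_comm]
  pos x v hv := by
    rw [roundInner_apply]
    refine real_inner_self_pos.2 (smul_ne_zero hr.ne' ?_)
    exact fun h => hv (sphereInclDeriv_injective n x (h.trans (map_zero _).symm))
  isVonNBounded x := by
    let D : EuclideanSpace ℝ (Fin n) →L[ℝ] EuclideanSpace ℝ (Fin (n + 1)) :=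
      r • sphereInclDeriv n x
    have hD : Function.Injective D := fun v w h =>
      sphereInclDeriv_injective n x (smul_right_injective _ hr.ne' h)
    obtain ⟨K, -, hK⟩ := D.toLinearMap.exists_antilipschitzWith (LinearMap.ker_eq_bot.2 hD)
    change Bornology.IsVonNBounded ℝ {v : EuclideanSpace ℝ (Fin n) | inner ℝ (D v) (D v) < 1}
    rw [NormedSpace.isVonNBounded_iff]
    refine (hK.isBounded_preimage (Metric.isBounded_ball (x := 0) (r := 1))).subset ?_
    intro v hv
    have hv' : inner ℝ (D v) (D v) < (1 : ℝ) := hv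
    rw [real_inner_self_eq_norm_sq] at hv'
    have : ‖D v‖ < 1 := by nlinarith [norm_nonneg (D v)]
    simpa using this
  contMDiff := roundInner_contMDiff n r

end Sphere

end

/-!
A Killing field of a round sphere is, near each point, the restriction of a linear field `x ↦ A x`
with `A` skew-symmetric. To see this, extend the field to a cone as a map homogeneous of degree one.
The extension is a Killing field of the flat metric, so its derivative is skew, and its second
derivative is a trilinear form that is symmetric in two arguments and skew in two others, hence
zero (`IsKillingOn.exists_skew_linear`). The Killing equation for the Lie derivative turns into a
statement about the derivative of the ambient vector-valued map because the Lie bracket acts on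
vector-valued functions as a commutator of derivations (`mvfderiv_mlieBracket`).

Orthonormality of `d` such fields on an open set is a quadratic relation, and so holds on all of
`ℝ ^ (n + 1)`. It says that the matrices, scaled by the radius, are anticommuting complex structures
`A i * A i = -1`, `A i * A j = -A j * A i`. By the Hurwitz-Radon theorem
(`IsAnticommuting.lt_radonHurwitz`) there are fewer than `ρ(n + 1)` of them. A Clifford-Killing
space yields an orthonormal family, by polarisation of the constant length, and so does the Killing
property, with `d = n`; moreover `ρ(m) ≤ m`, with equality only for `m = 1, 2, 4, 8`.

The Hurwitz-Radon bound is a statement on the dimension of real Clifford modules. Modules with one,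
two and four generators have dimension divisible by `2`, `4` and `8`. Multiplying four generators by
their volume element makes their squares positive, after which they pair with four generators of
negative square; each pair halves the module, so eight generators cost a factor `16`, which is the
periodicity of `ρ`. Conversely, skew families of `ρ(m) - 1` matrices are built from the left and the
right multiplications of quaternions by one doubling construction (`IsSkewFamily.double`), which also
gives the periodicity, and their linear combinations are Killing fields of constant length.
-/

noncomputable section

/-! ### Anticommuting families and Clifford modules -/

/-- A family of elements of a ring that anticommute pairwise and whose squares are the integers
`s i`. With all `s i = -1` in the endomorphisms of a real vector space, this is a module over the
Clifford algebra of a negative definite form. -/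
structure IsAnticommuting {κ R : Type*} [Ring R] (s : κ → ℤ) (T : κ → R) : Prop where
  sq : ∀ i, T i * T i = (s i : R)
  anti : ∀ i j, i ≠ j → T i * T j = -(T j * T i)

namespace IsAnticommuting

variable {κ μ R : Type*} [Ring R] {s : κ → ℤ} {T : κ → R}

theorem comp (h : IsAnticommuting s T) {φ : μ → κ} (hφ : Function.Injective φ) :
    IsAnticommuting (s ∘ φ) (T ∘ φ) :=
  ⟨fun i => h.sq (φ i), fun _ _ hij => h.anti _ _ (hφ.ne hij)⟩

theorem swap_mul (h : IsAnticommuting s T) {i j : κ} (hij : i ≠ j) (x : R) :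
    T i * (T j * x) = -(T j * (T i * x)) := by
  rw [← mul_assoc, h.anti i j hij, neg_mul, mul_assoc]

theorem commute_mul (h : IsAnticommuting s T) {i j k : κ} (hi : k ≠ i) (hj : k ≠ j) :
    Commute (T k) (T i * T j) := by
  rw [commute_iff_eq, h.swap_mul hi, h.anti k j hj, mul_neg, neg_neg, mul_assoc]

theorem anticommute_mul₃ (h : IsAnticommuting s T) {i j l k : κ} (hi : k ≠ i) (hj : k ≠ j)
    (hl : k ≠ l) : T k * (T i * (T j * T l)) = -(T i * (T j * T l) * T k) := by
  rw [h.swap_mul hi, (h.commute_mul hj hl).eq]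
  simp only [mul_assoc]

theorem commute_mul₃ (h : IsAnticommuting s T) {i j l : κ} (hij : i ≠ j) (hil : i ≠ l) :
    Commute (T i) (T i * (T j * T l)) :=
  (Commute.refl _).mul_right (h.commute_mul hij hil)

/-- The volume element of four of the generators anticommutes with each of them and commutes with
the others. Multiplying the four generators by it therefore keeps the family anticommuting and
changes the sign of the four squares. -/
theorem twist {s : Fin 4 ⊕ μ → ℤ} {T : Fin 4 ⊕ μ → R} (h : IsAnticommuting s T)
    (hs : ∀ i, s (.inl i) = -1) :
    ∃ T' : Fin 4 ⊕ μ → R,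
      IsAnticommuting (Sum.elim (fun _ => 1) (s ∘ Sum.inr)) T' := by
  set a := T (.inl 0) with ha
  set b := T (.inl 1) with hb
  set c := T (.inl 2) with hc
  set d := T (.inl 3) with hd
  set η := a * (b * (c * d)) with hη
  have aa' : ∀ i, T (.inl i) * T (.inl i) = -1 := fun i => by rw [h.sq, hs]; simp
  have comm : ∀ k, Commute (T (.inr k)) η := fun k => by
    have h1 := h.commute_mul (i := .inl 0) (j := .inl 1) (k := .inr k) (by simp) (by simp)
    have h2 := h.commute_mul (i := .inl 2) (j := .inl 3) (k := .inr k) (by simp) (by simp)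
    have := h1.mul_right h2
    rwa [mul_assoc] at this
  have sw : ∀ (i j : Fin 4) x, i ≠ j → T (.inl i) * (T (.inl j) * x)
      = -(T (.inl j) * (T (.inl i) * x)) := fun i j x hij => h.swap_mul (by simpa using hij) x
  have sw' : ∀ (i j : Fin 4), i ≠ j → T (.inl i) * T (.inl j)
      = -(T (.inl j) * T (.inl i)) := fun i j hij => h.anti _ _ (by simpa using hij)
  -- Rewriting with these rules sorts the factors of a product of the four generators.
  have s₁ : ∀ x, b * (a * x) = -(a * (b * x)) := fun x => sw 1 0 x (by decide)
  have s₂ : ∀ x, c * (a * x) = -(a * (c * x)) := fun x => sw 2 0 x (by decide)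
  have s₃ : ∀ x, d * (a * x) = -(a * (d * x)) := fun x => sw 3 0 x (by decide)
  have s₄ : ∀ x, c * (b * x) = -(b * (c * x)) := fun x => sw 2 1 x (by decide)
  have s₅ : ∀ x, d * (b * x) = -(b * (d * x)) := fun x => sw 3 1 x (by decide)
  have s₆ : ∀ x, d * (c * x) = -(c * (d * x)) := fun x => sw 3 2 x (by decide)
  have r₃ : d * a = -(a * d) := sw' 3 0 (by decide)
  have r₅ : d * b = -(b * d) := sw' 3 1 (by decide)
  have r₆ : d * c = -(c * d) := sw' 3 2 (by decide)
  have q₁ : a * a = -1 := aa' 0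
  have q₂ : b * b = -1 := aa' 1
  have q₃ : c * c = -1 := aa' 2
  have q₄ : d * d = -1 := aa' 3
  have anti : ∀ i, η * T (.inl i) = -(T (.inl i) * η) := fun i => by
    fin_cases i
    all_goals simp only [Fin.zero_eta, Fin.mk_one, Fin.reduceFinMk, hη, ← ha, ← hb, ← hc, ← hd,
      mul_assoc, s₁, s₂, s₃, s₄, s₅, s₆, r₃, r₅, r₆, mul_neg, neg_neg]
  have ηη : η * η = 1 := by
    simp only [hη, mul_assoc, s₁, s₂, s₃, s₄, s₅, s₆, q₁, q₂, q₃, q₄, mul_neg, neg_neg,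
      mul_one]
  have anti_mul : ∀ i x, η * (T (.inl i) * x) = -(T (.inl i) * (η * x)) := fun i x => by
    rw [← mul_assoc, anti, neg_mul, mul_assoc]
  refine ⟨Sum.elim (fun i => T (.inl i) * η) (fun k => T (.inr k)), ?_, ?_⟩
  · rintro (i | k)
    · simp only [Sum.elim_inl, mul_assoc, anti_mul, mul_neg, ηη, mul_one, aa', neg_neg,
        Int.cast_one]
    · simpa using h.sq (.inr k)
  · rintro (i | k) (j | l) hij
    · have hij' : i ≠ j := fun e => hij (by rw [e])
      simp only [Sum.elim_inl, mul_assoc, anti_mul, mul_neg, ηη, mul_one, sw' i j hij']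
    · simp only [Sum.elim_inl, Sum.elim_inr, mul_assoc, ← (comm l).eq]
      exact h.swap_mul (by simp) η
    · simp only [Sum.elim_inl, Sum.elim_inr, mul_assoc, ← (comm k).eq]
      exact h.swap_mul (by simp) η
    · simpa using h.anti (.inr k) (.inr l) hij

end IsAnticommuting

section Module

variable {V : Type*} [AddCommGroup V] [Module ℝ V]

/-- The endomorphism induced on the `1`-eigenspace of `P` by an endomorphism that commutes
with `P`. -/
def eigenRestrict {P T : Module.End ℝ V} (h : Commute T P) :
    Module.End ℝ (LinearMap.ker (P - 1)) :=
  T.restrict fun x hx => by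
    rw [LinearMap.mem_ker, LinearMap.sub_apply, Module.End.one_apply, sub_eq_zero] at hx ⊢
    rw [← Module.End.mul_apply, ← h.eq, Module.End.mul_apply, hx]

/-- The generators that commute with `P` keep their relations on the eigenspace. -/
theorem IsAnticommuting.eigenRestrict {κ : Type*} {s : κ → ℤ} {T : κ → Module.End ℝ V}
    (h : IsAnticommuting s T) {P : Module.End ℝ V} (hP : ∀ k, Commute (T k) P) :
    IsAnticommuting s (fun k => _root_.eigenRestrict (hP k)) := by
  have coe : ∀ k (x : LinearMap.ker (P - 1)),
      (_root_.eigenRestrict (hP k) x : V) = T k x := fun _ _ => rfl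
  refine ⟨fun i => ?_, fun i j hij => ?_⟩
  · ext x
    have := congr($(h.sq i) (x : V))
    simpa [coe] using this
  · ext x
    have := congr($(h.anti i j hij) (x : V))
    simpa [coe] using this

/-- The `1`-eigenspace of a traceless involution is half of the space. -/
theorem finrank_eq_two_mul_of_involution [FiniteDimensional ℝ V] {P : Module.End ℝ V}
    (hP : P * P = 1) (htr : LinearMap.trace ℝ V P = 0) :
    Module.finrank ℝ V = 2 * Module.finrank ℝ (LinearMap.ker (P - 1)) := by
  have hPP : ∀ x, P (P x) = x := fun x => congr($hP x)
  have proj : LinearMap.IsProj (LinearMap.ker (P - 1)) ((2⁻¹ : ℝ) • (1 + P)) := by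
    constructor
    · intro x
      simp [hPP, add_comm]
    · intro x hx
      rw [LinearMap.mem_ker, LinearMap.sub_apply, Module.End.one_apply, sub_eq_zero] at hx
      simp only [LinearMap.smul_apply, LinearMap.add_apply, Module.End.one_apply, hx]
      module
  have h := proj.trace
  rw [map_smul, map_add, htr, LinearMap.trace_one] at h
  have : (Module.finrank ℝ V : ℝ) = 2 * Module.finrank ℝ (LinearMap.ker (P - 1)) := by
    rw [← h]; simp
  exact_mod_cast this

theorem trace_eq_zero_of_anticommute [FiniteDimensional ℝ V] {P Q : Module.End ℝ V}
    (h : Q * P = -(P * Q)) (hQ : Q * Q = -1) : LinearMap.trace ℝ V P = 0 := by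
  have h1 : LinearMap.trace ℝ V (Q * (P * Q)) = LinearMap.trace ℝ V P := by
    rw [← mul_assoc, h, neg_mul, mul_assoc, hQ, mul_neg, mul_one, neg_neg]
  have h2 : LinearMap.trace ℝ V (Q * (P * Q)) = - LinearMap.trace ℝ V P := by
    rw [LinearMap.trace_mul_comm, mul_assoc, hQ, mul_neg, mul_one, map_neg]
  linarith

/-- A pair of generators with squares `1` and `-1` splits the representation into two halves, and
the remaining generators act on one of them. -/
theorem IsAnticommuting.exists_half [FiniteDimensional ℝ V] {κ μ : Type*} {s : κ → ℤ}
    {T : κ → Module.End ℝ V} (h : IsAnticommuting s T) {a b : κ} (hab : a ≠ b) (ha : s a = 1)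
    (hb : s b = -1) {φ : μ → κ} (hφ : Function.Injective φ) (hφa : ∀ i, φ i ≠ a)
    (hφb : ∀ i, φ i ≠ b) :
    ∃ (W : Submodule ℝ V) (T' : μ → Module.End ℝ W),
      IsAnticommuting (s ∘ φ) T' ∧ Module.finrank ℝ V = 2 * Module.finrank ℝ W := by
  have hb2 : T b * T b = -1 := by rw [h.sq, hb]; simp
  have ha2 : T a * T a = 1 := by rw [h.sq, ha]; simp
  refine ⟨_, _, (h.comp hφ).eigenRestrict
    (P := T a * T b) fun k => h.commute_mul (hφa k) (hφb k), ?_⟩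
  refine finrank_eq_two_mul_of_involution ?_ (trace_eq_zero_of_anticommute (Q := T b) ?_ hb2)
  · rw [mul_assoc, h.swap_mul hab.symm, mul_neg, ← mul_assoc, ha2, hb2, one_mul, neg_neg]
  · rw [h.swap_mul hab.symm, mul_assoc]

/-- Removing `k` generators of square `1` and `k` generators of square `-1` divides the dimension
of the representation by `2 ^ k`. -/
theorem IsAnticommuting.exists_submodule_of_pairs {κ : Type*} {s : κ → ℤ} (k : ℕ) :
    ∀ {V : Type*} [AddCommGroup V] [Module ℝ V] [FiniteDimensional ℝ V]
      {T : Fin k ⊕ (Fin k ⊕ κ) → Module.End ℝ V},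
      IsAnticommuting (Sum.elim (fun _ => 1) (Sum.elim (fun _ => -1) s)) T →
    ∃ (W : Submodule ℝ V) (T' : κ → Module.End ℝ W),
      IsAnticommuting s T' ∧ Module.finrank ℝ V = 2 ^ k * Module.finrank ℝ W := by
  induction k with
  | zero =>
    intro V _ _ _ T h
    have h' := (h.comp (φ := fun x : κ => .inr (.inr x))
      (Sum.inr_injective.comp Sum.inr_injective)).eigenRestrict (P := 1) fun _ => Commute.one_right _
    refine ⟨_, _, h', ?_⟩
    rw [pow_zero, one_mul, ← finrank_top ℝ V, sub_self, LinearMap.ker_zero]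
  | succ k ih =>
    intro V _ _ _ T h
    obtain ⟨W, T', h', hW⟩ := h.exists_half (a := .inl 0) (b := .inr (.inl 0)) (by simp) rfl rfl
      (φ := Sum.map Fin.succ (Sum.map Fin.succ id))
      (Sum.map_injective.2 ⟨Fin.succ_injective k,
        Sum.map_injective.2 ⟨Fin.succ_injective k, Function.injective_id⟩⟩)
      (by rintro (i | i | i) <;> simp [Fin.succ_ne_zero])
      (by rintro (i | i | i) <;> simp [Fin.succ_ne_zero])
    have hs : (Sum.elim (fun _ => 1) (Sum.elim (fun _ => -1) s) ∘
        Sum.map Fin.succ (Sum.map Fin.succ id) : Fin k ⊕ (Fin k ⊕ κ) → ℤ) =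
        Sum.elim (fun _ => 1) (Sum.elim (fun _ => -1) s) := by
      ext (i | i | i) <;> rfl
    rw [hs] at h'
    obtain ⟨W', T'', h'', hW'⟩ := ih h'
    let e := W'.equivMapOfInjective W.subtype W.injective_subtype
    refine ⟨W'.map W.subtype, fun i => e.conj (T'' i), ⟨fun i => ?_, fun i j hij => ?_⟩, ?_⟩
    · rw [Module.End.mul_eq_comp, ← LinearEquiv.conj_comp, ← Module.End.mul_eq_comp, h''.sq]
      ext x
      simp [LinearEquiv.conj_apply]
    · simp only [Module.End.mul_eq_comp, ← LinearEquiv.conj_comp]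
      rw [← Module.End.mul_eq_comp, h''.anti i j hij, map_neg, Module.End.mul_eq_comp]
    · rw [hW, hW', ← LinearEquiv.finrank_eq e]
      ring

end Module

/-! ### Dimensions of Clifford modules with few generators -/

theorem two_dvd_finrank {V : Type*} [AddCommGroup V] [Module ℝ V] [FiniteDimensional ℝ V]
    {J : Module.End ℝ V} (h : J * J = -1) : 2 ∣ Module.finrank ℝ V := by
  have h1 : LinearMap.det J * LinearMap.det J = (-1) ^ Module.finrank ℝ V := by
    rw [← map_mul, h, ← neg_one_smul ℝ (1 : Module.End ℝ V), LinearMap.det_smul, map_one, mul_one]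
  by_contra h2
  rw [(Nat.odd_iff.2 (by omega)).neg_one_pow] at h1
  nlinarith [mul_self_nonneg (LinearMap.det J)]

/-- Two anticommuting complex structures make a real vector space a module over the quaternions. -/
theorem four_dvd_finrank {V : Type*} [AddCommGroup V] [Module ℝ V]
    {I J : Module.End ℝ V} (hI : I * I = -1) (hJ : J * J = -1) (hIJ : J * I = -(I * J)) :
    4 ∣ Module.finrank ℝ V := by
  let B : QuaternionAlgebra.Basis (Module.End ℝ V) (-1 : ℝ) 0 (-1) :=
    { i := I, j := J, k := I * J
      i_mul_i := by simp [hI]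
      j_mul_j := by simp [hJ]
      i_mul_j := rfl
      j_mul_i := by simp [hIJ] }
  let f : Quaternion ℝ →ₐ[ℝ] Module.End ℝ V := B.liftHom
  let : Module (Quaternion ℝ) V := Module.compHom V f.toRingHom
  have hsmul : ∀ (q : Quaternion ℝ) (v : V), q • v = f q v := fun _ _ => rfl
  have : IsScalarTower ℝ (Quaternion ℝ) V := ⟨fun r q v => by simp [hsmul]⟩
  exact ⟨_, by rw [← Quaternion.finrank_eq_four (R := ℝ),
    Module.finrank_mul_finrank ℝ (Quaternion ℝ) V]⟩

/-- For four generators, the product `P` of three of them is an involution, which anticommutes with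
the fourth generator, and two of its factors act on the `1`-eigenspace as anticommuting complex
structures. -/
theorem eight_dvd_finrank {V : Type*} [AddCommGroup V] [Module ℝ V] [FiniteDimensional ℝ V]
    {T : Fin 4 → Module.End ℝ V} (h : IsAnticommuting (fun _ => -1) T) :
    8 ∣ Module.finrank ℝ V := by
  have sq : ∀ i, T i * T i = -1 := fun i => by simpa using h.sq i
  have h3 : T 3 * (T 0 * (T 1 * T 2)) = -(T 0 * (T 1 * T 2) * T 3) :=
    h.anticommute_mul₃ (by decide) (by decide) (by decide)
  have hP : T 0 * (T 1 * T 2) * (T 0 * (T 1 * T 2)) = 1 := by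
    simp only [mul_assoc, h.swap_mul (show (2 : Fin 4) ≠ 0 by decide),
      h.swap_mul (show (1 : Fin 4) ≠ 0 by decide), h.swap_mul (show (2 : Fin 4) ≠ 1 by decide),
      sq, mul_neg, neg_neg, mul_one]
  have hc0 : Commute (T 0) (T 0 * (T 1 * T 2)) := h.commute_mul₃ (by decide) (by decide)
  have hc1 : Commute (T 1) (T 0 * (T 1 * T 2)) := by
    have := h.commute_mul₃ (i := 1) (j := 0) (l := 2) (by decide) (by decide)
    rw [h.swap_mul (show (1 : Fin 4) ≠ 0 by decide)] at this
    simpa using this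
  have h' := (h.comp (φ := ![0, 1]) (by decide)).eigenRestrict (P := T 0 * (T 1 * T 2))
    (by intro k; fin_cases k; exacts [hc0, hc1])
  rw [finrank_eq_two_mul_of_involution hP (trace_eq_zero_of_anticommute h3 (sq 3))]
  exact mul_dvd_mul_left 2 (four_dvd_finrank (by simpa using h'.sq 0) (by simpa using h'.sq 1)
    (h'.anti 1 0 (by decide)))

/-- Eight generators of square `-1` can be removed at the price of a factor `16` in the dimension
of the representation. -/
theorem IsAnticommuting.exists_submodule_of_eight {V : Type*} [AddCommGroup V] [Module ℝ V]
    [FiniteDimensional ℝ V] {κ : Type*}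
    {T : Fin 4 ⊕ (Fin 4 ⊕ κ) → Module.End ℝ V} (h : IsAnticommuting (fun _ => -1) T) :
    ∃ (W : Submodule ℝ V) (T' : κ → Module.End ℝ W),
      IsAnticommuting (fun _ => -1) T' ∧ Module.finrank ℝ V = 16 * Module.finrank ℝ W := by
  obtain ⟨T', h'⟩ := h.twist fun _ => rfl
  refine IsAnticommuting.exists_submodule_of_pairs (s := fun _ : κ => -1) 4 (T := T') ?_
  convert h' using 2
  ext (i | k) <;> rfl

/-! ### The Radon-Hurwitz function -/

theorem radonHurwitz_pos (m : ℕ) : 0 < radonHurwitz m := by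
  unfold radonHurwitz; positivity

theorem radonHurwitz_sixteen_mul {m : ℕ} (hm : m ≠ 0) :
    radonHurwitz (16 * m) = radonHurwitz m + 8 := by
  have : padicValNat 2 (16 * m) = 4 + padicValNat 2 m := by
    rw [padicValNat.mul (by norm_num) hm, show 16 = 2 ^ 4 by norm_num, padicValNat.prime_pow]
  unfold radonHurwitz
  rw [this, show (4 + padicValNat 2 m) / 4 = padicValNat 2 m / 4 + 1 by omega,
    show (4 + padicValNat 2 m) % 4 = padicValNat 2 m % 4 by omega]
  ring

theorem two_pow_le_radonHurwitz {m k : ℕ} (hm : m ≠ 0) (hk : k ≤ 3) (h : 2 ^ k ∣ m) :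
    2 ^ k ≤ radonHurwitz m := by
  have hv : k ≤ padicValNat 2 m := (padicValNat_dvd_iff_le hm).1 h
  unfold radonHurwitz
  rcases Nat.lt_or_ge (padicValNat 2 m) 4 with h4 | h4
  · rw [Nat.mod_eq_of_lt h4]
    exact (Nat.pow_le_pow_right two_pos hv).trans (Nat.le_add_left _ _)
  · have h8 : 2 ^ k ≤ 2 ^ 3 := Nat.pow_le_pow_right two_pos hk
    exact h8.trans ((by omega : 2 ^ 3 ≤ 8 * (padicValNat 2 m / 4)).trans (Nat.le_add_right _ _))

theorem radonHurwitz_eq_of_not_dvd {m : ℕ} (hm : m ≠ 0) (h : ¬ 16 ∣ m) :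
    radonHurwitz m = 2 ^ padicValNat 2 m := by
  have hv : padicValNat 2 m < 4 := by
    by_contra! h4
    exact h ((padicValNat_dvd_iff_le (p := 2) (n := 4) hm).2 h4)
  rw [radonHurwitz, Nat.div_eq_of_lt hv, Nat.mod_eq_of_lt hv]
  simp

theorem radonHurwitz_le_self {m : ℕ} (hm : m ≠ 0) : radonHurwitz m ≤ m := by
  induction m using Nat.strong_induction_on with
  | _ m ih =>
    by_cases h : 16 ∣ m
    · obtain ⟨k, rfl⟩ := h
      rw [radonHurwitz_sixteen_mul (by omega)]
      have := ih k (by omega) (by omega)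
      omega
    · rw [radonHurwitz_eq_of_not_dvd hm h]
      exact Nat.le_of_dvd (Nat.pos_of_ne_zero hm) pow_padicValNat_dvd

theorem radonHurwitz_eq_self_iff {m : ℕ} (hm : m ≠ 0) :
    radonHurwitz m = m ↔ m = 1 ∨ m = 2 ∨ m = 4 ∨ m = 8 := by
  by_cases h : 16 ∣ m
  · obtain ⟨k, rfl⟩ := h
    rw [radonHurwitz_sixteen_mul (by omega)]
    have := radonHurwitz_le_self (m := k) (by omega)
    omega
  · rw [radonHurwitz_eq_of_not_dvd hm h]
    have hv : padicValNat 2 m < 4 := by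
      by_contra! h4
      exact h ((padicValNat_dvd_iff_le (p := 2) (n := 4) hm).2 h4)
    constructor
    · intro h2
      rw [← h2]
      interval_cases padicValNat 2 m <;> simp
    · rintro (rfl | rfl | rfl | rfl)
      · simp
      · simp
      · rw [show 4 = 2 ^ 2 by norm_num, padicValNat.prime_pow]
      · rw [show 8 = 2 ^ 3 by norm_num, padicValNat.prime_pow]

/-! ### The Hurwitz-Radon bound -/

/-- **Hurwitz-Radon theorem**, upper bound. Fewer than eight generators are handled by the
divisibility of the dimension by `2`, `4` and `8`; eight generators are removed at a time. -/
theorem IsAnticommuting.lt_radonHurwitz (d : ℕ) {V : Type*} [AddCommGroup V] [Module ℝ V]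
    [FiniteDimensional ℝ V] [Nontrivial V] {T : Fin d → Module.End ℝ V}
    (h : IsAnticommuting (fun _ => -1) T) : d < radonHurwitz (Module.finrank ℝ V) := by
  induction d using Nat.strong_induction_on generalizing V with
  | _ d ih =>
    have hpos : Module.finrank ℝ V ≠ 0 := Module.finrank_pos.ne'
    have sq : ∀ i, T i * T i = -1 := fun i => by simpa using h.sq i
    rcases Nat.lt_or_ge d 8 with hd | hd
    · rcases Nat.lt_or_ge d 4 with hd4 | hd4
      · rcases Nat.lt_or_ge d 2 with hd2 | hd2
        · rcases Nat.eq_zero_or_pos d with rfl | hd0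
          · exact radonHurwitz_pos _
          · exact hd2.trans_le (two_pow_le_radonHurwitz (k := 1) hpos (by norm_num)
              (two_dvd_finrank (sq ⟨0, hd0⟩)))
        · exact hd4.trans_le (two_pow_le_radonHurwitz (k := 2) hpos (by norm_num)
            (four_dvd_finrank (sq ⟨0, by omega⟩) (sq ⟨1, by omega⟩) (h.anti _ _ (by simp))))
      · exact hd.trans_le (two_pow_le_radonHurwitz (k := 3) hpos (by norm_num)
          (eight_dvd_finrank (h.comp (Fin.castLE_injective hd4))))
    · obtain ⟨e, rfl⟩ : ∃ e, d = 4 + (4 + e) := ⟨d - 8, by omega⟩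
      obtain ⟨W, T', h', hW⟩ := IsAnticommuting.exists_submodule_of_eight
        (h.comp (φ := finSumFinEquiv ∘ Sum.map id finSumFinEquiv)
          (finSumFinEquiv.injective.comp
            (Sum.map_injective.2 ⟨Function.injective_id, finSumFinEquiv.injective⟩)))
      have hW0 : Module.finrank ℝ W ≠ 0 := by omega
      have : Nontrivial W := Module.nontrivial_of_finrank_pos (Nat.pos_of_ne_zero hW0)
      have := ih e (by omega) h'
      rw [hW, radonHurwitz_sixteen_mul hW0]
      omega

/-! ### Skew families of matrices -/

/-- A family of skew-symmetric real matrices that anticommute pairwise and have square `-1`. -/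
structure IsSkewFamily {κ ι : Type*} [Fintype ι] [DecidableEq ι] (T : κ → Matrix ι ι ℝ) : Prop where
  anticommuting : IsAnticommuting (fun _ => -1) T
  skew : ∀ k, (T k).transpose = -T k

namespace IsSkewFamily

open Matrix Kronecker

variable {κ μ ι ι' : Type*} [Fintype ι] [DecidableEq ι] [Fintype ι'] [DecidableEq ι']
  {T : κ → Matrix ι ι ℝ}

theorem sq (h : IsSkewFamily T) (k : κ) : T k * T k = -1 := by
  simpa using h.anticommuting.sq k

theorem anti (h : IsSkewFamily T) {k l : κ} (hkl : k ≠ l) : T k * T l = -(T l * T k) :=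
  h.anticommuting.anti k l hkl

theorem of_isEmpty [IsEmpty κ] (T : κ → Matrix ι ι ℝ) : IsSkewFamily T :=
  ⟨⟨isEmptyElim, isEmptyElim⟩, isEmptyElim⟩

theorem comp (h : IsSkewFamily T) {φ : μ → κ} (hφ : Function.Injective φ) :
    IsSkewFamily (T ∘ φ) :=
  ⟨h.anticommuting.comp hφ, fun k => h.skew (φ k)⟩

/-- A ring homomorphism between matrix rings that respects transposition carries skew families to
skew families. -/
theorem of_ringHom {S : Type*} [Ring S] {T : κ → Matrix ι ι S}
    (φ : Matrix ι ι S →+* Matrix ι' ι' ℝ) (hφ : ∀ A, φ Aᵀ = (φ A)ᵀ)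
    (hsq : ∀ k, T k * T k = -1) (hanti : ∀ k l, k ≠ l → T k * T l = -(T l * T k))
    (hskew : ∀ k, (T k)ᵀ = -T k) : IsSkewFamily (fun k => φ (T k)) := by
  refine ⟨⟨fun k => ?_, fun k l hkl => ?_⟩, fun k => ?_⟩
  · rw [← map_mul, hsq, map_neg, map_one, Int.cast_neg, Int.cast_one]
  · rw [← map_mul, hanti k l hkl, map_neg, map_mul]
  · rw [← map_neg, ← hskew, hφ]

theorem reindex (h : IsSkewFamily T) (e : ι ≃ ι') :
    IsSkewFamily (fun k => Matrix.reindex e e (T k)) :=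
  .of_ringHom (Matrix.reindexAlgEquiv ℝ ℝ e).toRingEquiv.toRingHom (fun _ => rfl) h.sq
    (fun _ _ => h.anti) h.skew

theorem kronecker_one (h : IsSkewFamily T) :
    IsSkewFamily (fun k => T k ⊗ₖ (1 : Matrix ι' ι' ℝ)) := by
  refine .of_ringHom
    { toFun := fun A => A ⊗ₖ (1 : Matrix ι' ι' ℝ)
      map_one' := one_kronecker_one
      map_mul' := fun A B => by rw [← mul_kronecker_mul, one_mul]
      map_zero' := zero_kronecker _
      map_add' := fun A B => add_kronecker A B _ } (fun A => ?_) h.sq (fun _ _ => h.anti) h.skew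
  simp [← kroneckerMap_transpose]

theorem one_kronecker (h : IsSkewFamily T) :
    IsSkewFamily (fun k => (1 : Matrix ι' ι' ℝ) ⊗ₖ T k) := by
  refine .of_ringHom
    { toFun := fun A => (1 : Matrix ι' ι' ℝ) ⊗ₖ A
      map_one' := one_kronecker_one
      map_mul' := fun A B => by rw [← mul_kronecker_mul, one_mul]
      map_zero' := kronecker_zero _
      map_add' := fun A B => kronecker_add _ A B } (fun A => ?_) h.sq (fun _ _ => h.anti) h.skew
  simp [← kroneckerMap_transpose]

/-- Two families on `ℝ ^ ι` that commute with each other combine, together with one more complex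
structure, to a family on `ℝ ^ ι × ℝ ^ ι`. -/
theorem double {F : μ → Matrix ι ι ℝ} (hF : IsSkewFamily F) (hT : IsSkewFamily T)
    (hc : ∀ i k, Commute (F i) (T k)) :
    IsSkewFamily (Sum.elim (fun i => fromBlocks 0 (F i) (F i) 0)
      (Sum.elim (fun _ : Unit => fromBlocks 0 1 (-1) 0)
        (fun k => fromBlocks (T k) 0 0 (-T k)))) := by
  refine ⟨⟨?_, ?_⟩, ?_⟩
  · rintro (i | _ | k) <;>
      simp [fromBlocks_multiply, hF.sq, hT.sq, ← fromBlocks_one, fromBlocks_neg]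
  · rintro (i | u | k) (j | v | l) h
    · simp [fromBlocks_multiply, fromBlocks_neg, hF.anti (fun e => h (by rw [e]) : i ≠ j)]
    · simp [fromBlocks_multiply, fromBlocks_neg]
    · simp [fromBlocks_multiply, fromBlocks_neg, (hc i l).eq]
    · simp [fromBlocks_multiply, fromBlocks_neg]
    · exact absurd rfl h
    · simp [fromBlocks_multiply, fromBlocks_neg]
    · simp [fromBlocks_multiply, fromBlocks_neg, (hc j k).eq]
    · simp [fromBlocks_multiply, fromBlocks_neg]
    · simp [fromBlocks_multiply, fromBlocks_neg, hT.anti (fun e => h (by rw [e]) : k ≠ l)]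
  · rintro (i | _ | k) <;>
      simp [fromBlocks_transpose, fromBlocks_neg, hF.skew, hT.skew]

/-- A skew family can be indexed by `Fin d`, for any `d` at most its size, with matrices on
`Fin m`. -/
theorem exists_fin (h : IsSkewFamily T) {d m : ℕ} [Fintype κ] (hd : d ≤ Fintype.card κ)
    (hm : Fintype.card ι = m) : ∃ T' : Fin d → Matrix (Fin m) (Fin m) ℝ, IsSkewFamily T' :=
  ⟨_, (h.reindex (Fintype.equivFinOfCardEq hm)).comp (φ := (Fintype.equivFin κ).symm ∘ Fin.castLE hd)
    ((Fintype.equivFin κ).symm.injective.comp (Fin.castLE_injective hd))⟩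

end IsSkewFamily

/-- Left multiplications by the quaternion units `i`, `j`, `k`. -/
def quaternionLeft : Fin 3 → Matrix (Fin 4) (Fin 4) ℤ :=
  ![!![0, -1, 0, 0; 1, 0, 0, 0; 0, 0, 0, -1; 0, 0, 1, 0],
    !![0, 0, -1, 0; 0, 0, 0, 1; 1, 0, 0, 0; 0, -1, 0, 0],
    !![0, 0, 0, -1; 0, 0, -1, 0; 0, 1, 0, 0; 1, 0, 0, 0]]

/-- Right multiplications by the quaternion units `i`, `j`, `k`. -/
def quaternionRight : Fin 3 → Matrix (Fin 4) (Fin 4) ℤ :=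
  ![!![0, -1, 0, 0; 1, 0, 0, 0; 0, 0, 0, 1; 0, 0, -1, 0],
    !![0, 0, -1, 0; 0, 0, 0, -1; 1, 0, 0, 0; 0, 1, 0, 0],
    !![0, 0, 0, -1; 0, 0, 1, 0; 0, -1, 0, 0; 1, 0, 0, 0]]

theorem isSkewFamily_quaternionLeft :
    IsSkewFamily (fun k => (Int.castRingHom ℝ).mapMatrix (quaternionLeft k)) :=
  .of_ringHom (Int.castRingHom ℝ).mapMatrix (fun _ => rfl) (by decide) (by decide) (by decide)

theorem isSkewFamily_quaternionRight :
    IsSkewFamily (fun k => (Int.castRingHom ℝ).mapMatrix (quaternionRight k)) :=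
  .of_ringHom (Int.castRingHom ℝ).mapMatrix (fun _ => rfl) (by decide) (by decide) (by decide)

theorem commute_quaternionLeft_quaternionRight (i j : Fin 3) :
    Commute ((Int.castRingHom ℝ).mapMatrix (quaternionLeft i))
      ((Int.castRingHom ℝ).mapMatrix (quaternionRight j)) := by
  have : ∀ i j, quaternionLeft i * quaternionRight j = quaternionRight j * quaternionLeft i := by
    decide
  rw [commute_iff_eq, ← map_mul, this, map_mul]

/-- On `ℝ ^ 8` there are seven anticommuting complex structures: the left and the right
multiplications of quaternions commute, so they can be doubled. -/
theorem exists_isSkewFamily_eight :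
    ∃ T : Fin 7 → Matrix (Fin 8) (Fin 8) ℝ, IsSkewFamily T :=
  (isSkewFamily_quaternionLeft.double isSkewFamily_quaternionRight
    commute_quaternionLeft_quaternionRight).exists_fin (by simp) (by simp)

/-- **Hurwitz-Radon theorem**, existence. The step from `m` to `16 * m` doubles the seven matrices of
size `8` with a family of size `m`, which commute as they act on different tensor factors. -/
theorem exists_isSkewFamily {m : ℕ} (hm : m ≠ 0) :
    ∃ T : Fin (radonHurwitz m - 1) → Matrix (Fin m) (Fin m) ℝ, IsSkewFamily T := by
  induction m using Nat.strong_induction_on with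
  | _ m ih =>
    by_cases h : 16 ∣ m
    · obtain ⟨k, rfl⟩ := h
      have hk : k ≠ 0 := by omega
      obtain ⟨T, hT⟩ := ih k (by omega) hk
      obtain ⟨F, hF⟩ := exists_isSkewFamily_eight
      refine ((hF.kronecker_one (ι' := Fin k)).double (hT.one_kronecker (ι' := Fin 8))
        fun i l => ?_).exists_fin ?_ ?_
      · rw [commute_iff_eq, ← Matrix.mul_kronecker_mul, ← Matrix.mul_kronecker_mul]
        simp
      · have := radonHurwitz_pos k
        simp only [radonHurwitz_sixteen_mul hk, Fintype.card_sum, Fintype.card_fin, Fintype.card_unit]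
        omega
      · simp
        ring
    · rw [radonHurwitz_eq_of_not_dvd hm h]
      have hv : padicValNat 2 m < 4 := by
        by_contra! h4
        exact h ((padicValNat_dvd_iff_le (p := 2) (n := 4) hm).2 h4)
      obtain ⟨k, hk⟩ : 2 ^ padicValNat 2 m ∣ m := pow_padicValNat_dvd
      generalize padicValNat 2 m = v at hv hk ⊢
      obtain ⟨T, hT⟩ : ∃ T : Fin (2 ^ v - 1) → Matrix (Fin (2 ^ v)) (Fin (2 ^ v)) ℝ,
          IsSkewFamily T := by
        interval_cases v
        · exact ⟨fun _ => 0, .of_isEmpty (κ := Fin 0) _⟩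
        · exact (IsSkewFamily.double (ι := Unit) (.of_isEmpty (κ := Empty) fun _ => 0)
            (.of_isEmpty (κ := Empty) fun _ => 0) isEmptyElim).exists_fin (by simp) (by simp)
        · exact isSkewFamily_quaternionLeft.exists_fin (by simp) (by simp)
        · exact exists_isSkewFamily_eight
      exact (hT.kronecker_one (ι' := Fin k)).exists_fin (by simp) (by simp [← hk])

/-! ### The Lie bracket as a commutator of derivations -/

section Bracket
open VectorField Set Filter Topology

variable {n : ℕ} {M : Type*} [TopologicalSpace M] [ChartedSpace (EuclideanSpace ℝ (Fin n)) M]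
  {F : Type*} [NormedAddCommGroup F] [NormedSpace ℝ F]

/-- The vector field `X` in the chart at `x`. -/
def chartField (X : VecField n M) (x : M) (u : EuclideanSpace ℝ (Fin n)) :
    EuclideanSpace ℝ (Fin n) :=
  mpullbackWithin 𝓘(ℝ, EuclideanSpace ℝ (Fin n)) (𝓡 n) (extChartAt (𝓡 n) x).symm X
    (range (𝓡 n)) u

theorem mvfderiv_eq_fderiv_extChartAt {f : M → F} {x : M}
    (hf : MDifferentiableAt (𝓡 n) 𝓘(ℝ, F) f x) (v : TangentSpace (𝓡 n) x) :
    mvfderiv (𝓡 n) f x v =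
      fderiv ℝ (f ∘ (extChartAt (𝓡 n) x).symm) (extChartAt (𝓡 n) x x) v := by
  rw [hf.mvfderiv]
  simp only [modelWithCornersSelf_coe, range_id, fderivWithin_univ]
  rfl

theorem contDiffAt_comp_extChartAt_symm {f : M → F} {x : M}
    (hf : ContMDiffAt (𝓡 n) 𝓘(ℝ, F) ∞ f x) :
    ContDiffAt ℝ ∞ (f ∘ (extChartAt (𝓡 n) x).symm) (extChartAt (𝓡 n) x x) := by
  have := (contMDiffAt_iff.1 hf).2
  rw [modelWithCornersSelf_coe, range_id, contDiffWithinAt_univ] at this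
  exact this

variable [IsManifold (𝓡 n) ∞ M]

/-- The derivative of `f` along a vector field, read in the chart at `x`. -/
theorem eventually_mvfderiv_apply_eq {f : M → F} {x : M}
    (hf : ContMDiffAt (𝓡 n) 𝓘(ℝ, F) ∞ f x) (X : VecField n M) :
    ∀ᶠ u in 𝓝 (extChartAt (𝓡 n) x x),
      mvfderiv (𝓡 n) f ((extChartAt (𝓡 n) x).symm u) (X ((extChartAt (𝓡 n) x).symm u)) =
      fderiv ℝ (f ∘ (extChartAt (𝓡 n) x).symm) u
        (chartField X x u) := by
  have : IsManifold (𝓡 n) 1 M := IsManifold.of_le (n := ∞) (by norm_cast)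
  have hsm : ∀ᶠ y in 𝓝 x, MDifferentiableAt (𝓡 n) 𝓘(ℝ, F) f y := by
    have h1 : ContMDiffAt (𝓡 n) 𝓘(ℝ, F) 1 f x := hf.of_le (by norm_cast)
    filter_upwards [(contMDiffAt_iff_contMDiffAt_nhds (by simp)).1 h1] with y hy
    exact hy.mdifferentiableAt one_ne_zero
  have hc : Tendsto (extChartAt (𝓡 n) x).symm (𝓝 (extChartAt (𝓡 n) x x)) (𝓝 x) := by
    have := continuousAt_extChartAt_symm (I := 𝓡 n) x
    rwa [ContinuousAt, extChartAt_to_inv] at this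
  filter_upwards [hc.eventually hsm, extChartAt_target_mem_nhds (I := 𝓡 n) x] with u hu hut
  have h2 := mdifferentiableWithinAt_extChartAt_symm (I := 𝓡 n) hut
  have h3 : fderiv ℝ (f ∘ (extChartAt (𝓡 n) x).symm) u =
      (mvfderiv (𝓡 n) f ((extChartAt (𝓡 n) x).symm u)).comp
        (mfderivWithin 𝓘(ℝ, EuclideanSpace ℝ (Fin n)) (𝓡 n) (extChartAt (𝓡 n) x).symm
          (range (𝓡 n)) u) := by
    have := mfderiv_comp_mfderivWithin u hu h2 (by simp [uniqueMDiffWithinAt_univ])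
    rw [modelWithCornersSelf_coe, range_id, mfderivWithin_univ, mfderiv_eq_fderiv] at this
    rw [modelWithCornersSelf_coe, range_id, this, mfderivWithin_univ]
    rfl
  rw [h3]
  have h5 := (isInvertible_mfderivWithin_extChartAt_symm (I := 𝓡 n) hut)
  exact congrArg _ (h5.self_apply_inverse _).symm


theorem differentiableAt_chartField {X : VecField n M} {x : M}
    (hX : MDifferentiableAt (𝓡 n) (𝓡 n).tangent
      (fun y => (⟨y, X y⟩ : TangentBundle (𝓡 n) M)) x) :
    DifferentiableAt ℝ (chartField X x)
      (extChartAt (𝓡 n) x x) := by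
  have : IsManifold (𝓡 n) 2 M := IsManifold.of_le (n := ∞) (by norm_cast)
  have h := MDifferentiableWithinAt.differentiableWithinAt_mpullbackWithin_vectorField
    (mdifferentiableWithinAt_univ.2 hX)
  have h' : DifferentiableWithinAt ℝ (chartField X x) univ (extChartAt (𝓡 n) x x) := by
    refine h.mono ?_
    simp
  exact differentiableWithinAt_univ.1 h'

theorem chartField_self (X : VecField n M) (x : M) :
    chartField X x (extChartAt (𝓡 n) x x) = X x := by
  have : IsManifold (𝓡 n) 1 M := IsManifold.of_le (n := ∞) (by norm_cast)
  have e : ∀ y, y = x → (X y : EuclideanSpace ℝ (Fin n)) = X x := by rintro _ rfl; rfl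
  have h : (mfderivWithin 𝓘(ℝ, EuclideanSpace ℝ (Fin n)) (𝓡 n) (extChartAt (𝓡 n) x).symm
      (range (𝓡 n)) (extChartAt (𝓡 n) x x) : EuclideanSpace ℝ (Fin n) →L[ℝ]
      EuclideanSpace ℝ (Fin n)) = .id ℝ _ := mfderivWithin_range_extChartAt_symm
  change ContinuousLinearMap.inverse (M := EuclideanSpace ℝ (Fin n))
    (M₂ := EuclideanSpace ℝ (Fin n)) _ _ = _
  erw [h, ContinuousLinearMap.inverse_id]
  exact e _ (extChartAt_to_inv x)

theorem mlieBracket_eq_lieBracket_chartField (X Y : VecField n M) (x : M) :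
    mlieBracket (𝓡 n) X Y x =
      lieBracket ℝ (chartField X x) (chartField Y x) (extChartAt (𝓡 n) x x) := by
  have : IsManifold (𝓡 n) 1 M := IsManifold.of_le (n := ∞) (by norm_cast)
  have h : (mfderiv (𝓡 n) 𝓘(ℝ, EuclideanSpace ℝ (Fin n)) (extChartAt (𝓡 n) x) x :
      EuclideanSpace ℝ (Fin n) →L[ℝ] EuclideanSpace ℝ (Fin n)) = .id ℝ _ :=
    mfderiv_extChartAt_self
  have hs : (extChartAt (𝓡 n) x).symm ⁻¹' univ ∩ range (𝓡 n) = univ := by simp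
  change ContinuousLinearMap.inverse (M := EuclideanSpace ℝ (Fin n))
    (M₂ := EuclideanSpace ℝ (Fin n)) _ (lieBracketWithin ℝ (chartField X x) (chartField Y x)
      ((extChartAt (𝓡 n) x).symm ⁻¹' univ ∩ range (𝓡 n)) _) = _
  rw [hs, lieBracketWithin_univ]
  erw [h, ContinuousLinearMap.inverse_id]
  rfl

theorem mdifferentiableAt_mvfderiv_apply {f : M → F} {x : M} {X : VecField n M}
    (hf : ContMDiffAt (𝓡 n) 𝓘(ℝ, F) ∞ f x)
    (hX : MDifferentiableAt (𝓡 n) (𝓡 n).tangent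
      (fun y => (⟨y, X y⟩ : TangentBundle (𝓡 n) M)) x) :
    MDifferentiableAt (𝓡 n) 𝓘(ℝ, F) (fun y => mvfderiv (𝓡 n) f y (X y)) x := by
  have : IsManifold (𝓡 n) 1 M := IsManifold.of_le (n := ∞) (by norm_cast)
  have h1 := (contDiffAt_comp_extChartAt_symm hf).fderiv_right (m := 1) (by norm_cast)
  have h2 := (h1.differentiableAt one_ne_zero).clm_apply
    (differentiableAt_chartField hX)
  have h3 := h2.mdifferentiableAt.comp x
    (mdifferentiableAt_extChartAt (I := 𝓡 n) (mem_chart_source _ x))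
  refine h3.congr_of_eventuallyEq ?_
  filter_upwards [(continuousAt_extChartAt (I := 𝓡 n) x).eventually
    (eventually_mvfderiv_apply_eq hf X), extChartAt_source_mem_nhds (I := 𝓡 n) x] with y hy hys
  rw [(extChartAt (𝓡 n) x).left_inv hys] at hy
  exact hy

/-- The Lie bracket acts on vector-valued functions as the commutator of the derivations. -/
theorem mvfderiv_mlieBracket {f : M → F} {x : M} {X Y : VecField n M}
    (hf : ContMDiffAt (𝓡 n) 𝓘(ℝ, F) ∞ f x)
    (hX : MDifferentiableAt (𝓡 n) (𝓡 n).tangent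
      (fun y => (⟨y, X y⟩ : TangentBundle (𝓡 n) M)) x)
    (hY : MDifferentiableAt (𝓡 n) (𝓡 n).tangent
      (fun y => (⟨y, Y y⟩ : TangentBundle (𝓡 n) M)) x) :
    mvfderiv (𝓡 n) f x (mlieBracket (𝓡 n) X Y x) =
      mvfderiv (𝓡 n) (fun y => mvfderiv (𝓡 n) f y (Y y)) x (X x) -
        mvfderiv (𝓡 n) (fun y => mvfderiv (𝓡 n) f y (X y)) x (Y x) := by
  have : IsManifold (𝓡 n) 1 M := IsManifold.of_le (n := ∞) (by norm_cast)
  have h0 := contDiffAt_comp_extChartAt_symm hf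
  have h1 := (h0.fderiv_right (m := 1) (by norm_cast)).differentiableAt one_ne_zero
  have second : ∀ {X : VecField n M}, MDifferentiableAt (𝓡 n) (𝓡 n).tangent
      (fun y => (⟨y, X y⟩ : TangentBundle (𝓡 n) M)) x → ∀ v : TangentSpace (𝓡 n) x,
      mvfderiv (𝓡 n) (fun y => mvfderiv (𝓡 n) f y (X y)) x v =
      fderiv ℝ (fderiv ℝ (f ∘ (extChartAt (𝓡 n) x).symm)) (extChartAt (𝓡 n) x x) v (X x) +
      fderiv ℝ (f ∘ (extChartAt (𝓡 n) x).symm) (extChartAt (𝓡 n) x x)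
        (fderiv ℝ (chartField X x)
        (extChartAt (𝓡 n) x x) v) := by
    intro X hX v
    rw [mvfderiv_eq_fderiv_extChartAt (mdifferentiableAt_mvfderiv_apply hf hX)]
    have e : (fun y => mvfderiv (𝓡 n) f y (X y)) ∘ (extChartAt (𝓡 n) x).symm =ᶠ[
        𝓝 (extChartAt (𝓡 n) x x)] _ := eventually_mvfderiv_apply_eq hf X
    rw [e.fderiv_eq, fderiv_clm_apply h1 (differentiableAt_chartField hX)]
    rw [chartField_self]
    exact add_comm _ _
  rw [second hX, second hY]
  have symm := (h0.isSymmSndFDerivAt (by simp; norm_cast)).eq (X x) (Y x)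
  rw [mvfderiv_eq_fderiv_extChartAt (hf.mdifferentiableAt (by simp)),
    mlieBracket_eq_lieBracket_chartField, lieBracket_eq]
  beta_reduce
  rw [chartField_self, chartField_self, symm, map_sub]
  abel

end Bracket

/-! ### Vector fields on the sphere as maps to the ambient space -/

section SphereFields
open VectorField Set Filter Topology Module

-- Instance search would otherwise find another route to the charted space `EuclideanSpace ℝ (Fin k)`.
attribute [local instance] chartedSpaceSelf

variable {n : ℕ}

theorem contMDiff_coe_stdSphere (n : ℕ) :
    ContMDiff (𝓡 n) 𝓘(ℝ, EuclideanSpace ℝ (Fin (n + 1))) ∞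
      ((↑) : StdSphere n → EuclideanSpace ℝ (Fin (n + 1))) := by
  have := Fact.mk (@finrank_euclideanSpace_fin ℝ _ (n + 1))
  exact contMDiff_coe_sphere

theorem range_sphereInclDeriv (x : StdSphere n) :
    (sphereInclDeriv n x).range = (ℝ ∙ (x : EuclideanSpace ℝ (Fin (n + 1))))ᗮ := by
  have := Fact.mk (@finrank_euclideanSpace_fin ℝ _ (n + 1))
  exact range_mvfderiv_subtypeVal x

theorem inner_sphereInclDeriv (x : StdSphere n) (v : TangentSpace (𝓡 n) x) :
    inner ℝ (x : EuclideanSpace ℝ (Fin (n + 1))) (sphereInclDeriv n x v) = 0 := by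
  have : sphereInclDeriv n x v ∈ (sphereInclDeriv n x).range := ⟨v, rfl⟩
  rw [range_sphereInclDeriv, Submodule.mem_orthogonal_singleton_iff_inner_right] at this
  exact this

theorem exists_sphereInclDeriv_eq (x : StdSphere n) {u : EuclideanSpace ℝ (Fin (n + 1))}
    (hu : inner ℝ (x : EuclideanSpace ℝ (Fin (n + 1))) u = 0) :
    ∃ v : TangentSpace (𝓡 n) x, sphereInclDeriv n x v = u := by
  rw [← Submodule.mem_orthogonal_singleton_iff_inner_right, ← range_sphereInclDeriv] at hu
  exact hu

/-- A vector field on the sphere as a map to the ambient Euclidean space. -/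
def ambientField (X : VecField n (StdSphere n)) (x : StdSphere n) :
    EuclideanSpace ℝ (Fin (n + 1)) :=
  sphereInclDeriv n x (X x)

theorem inner_ambientField (X : VecField n (StdSphere n)) (x : StdSphere n) :
    inner ℝ (x : EuclideanSpace ℝ (Fin (n + 1))) (ambientField X x) = 0 :=
  inner_sphereInclDeriv x (X x)

/-- The ambient form of a smooth field is the second component of the tangent map of the inclusion
along the field. -/
theorem IsSmoothOn.contMDiffOn_ambientField {X : VecField n (StdSphere n)} {U : Set (StdSphere n)}
    (hX : IsSmoothOn X U) :
    ContMDiffOn (𝓡 n) 𝓘(ℝ, EuclideanSpace ℝ (Fin (n + 1))) ∞ (ambientField X) U := by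
  have : IsManifold (𝓡 n) 1 (StdSphere n) := IsManifold.of_le (n := ∞) (by norm_cast)
  have h1 := (contMDiff_coe_stdSphere n).contMDiff_tangentMap (m := ∞) (by norm_cast)
  have h2 := (contMDiff_snd_tangentBundle_modelSpace (EuclideanSpace ℝ (Fin (n + 1)))
    𝓘(ℝ, EuclideanSpace ℝ (Fin (n + 1))) (n := ∞)).comp h1
  exact h2.comp_contMDiffOn hX

theorem IsSmoothOn.mdifferentiableAt {X : VecField n (StdSphere n)} {U : Set (StdSphere n)}
    (hX : IsSmoothOn X U) (hU : IsOpen U) {x : StdSphere n} (hx : x ∈ U) :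
    MDifferentiableAt (𝓡 n) (𝓡 n).tangent
      (fun y => (⟨y, X y⟩ : TangentBundle (𝓡 n) (StdSphere n))) x :=
  (hX.contMDiffAt (hU.mem_nhds hx)).mdifferentiableAt (by simp)

/-- The radial projection to the unit sphere. The value at the origin is arbitrary. -/
def sphereRetract (n : ℕ) (y : EuclideanSpace ℝ (Fin (n + 1))) : StdSphere n :=
  if h : y = 0 then ⟨EuclideanSpace.single 0 1, by simp⟩
  else ⟨‖y‖⁻¹ • y, by simp [norm_smul, h]⟩

theorem coe_sphereRetract {y : EuclideanSpace ℝ (Fin (n + 1))} (hy : y ≠ 0) :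
    (sphereRetract n y : EuclideanSpace ℝ (Fin (n + 1))) = ‖y‖⁻¹ • y := by
  simp [sphereRetract, hy]

theorem sphereRetract_coe (x : StdSphere n) : sphereRetract n x = x := by
  have hx : (x : EuclideanSpace ℝ (Fin (n + 1))) ≠ 0 := ne_zero_of_mem_unit_sphere x
  ext1
  rw [coe_sphereRetract hx]
  simp

theorem contMDiffOn_sphereRetract (n : ℕ) :
    ContMDiffOn 𝓘(ℝ, EuclideanSpace ℝ (Fin (n + 1))) (𝓡 n) ∞ (sphereRetract n) {0}ᶜ := by
  have := Fact.mk (@finrank_euclideanSpace_fin ℝ _ (n + 1))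
  have hf : ContDiffOn ℝ ∞ (fun y => (sphereRetract n y : EuclideanSpace ℝ (Fin (n + 1)))) {0}ᶜ := by
    refine ContDiffOn.congr (f := fun y => ‖y‖⁻¹ • y) ?_ fun y hy => coe_sphereRetract hy
    exact ((contDiffOn_id.norm ℝ fun y hy => hy).inv
      fun y (hy : y ≠ 0) => norm_ne_zero_iff.2 hy).smul
      contDiffOn_id
  rw [contMDiffOn_iff_target]
  refine ⟨continuousOn_iff_continuous_domRestrict.2 (continuous_induced_rng.2
    (continuousOn_iff_continuous_domRestrict.1 hf.continuousOn)), ?_⟩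
  intro v
  let U : _ ≃ₗᵢ[ℝ] _ := (OrthonormalBasis.fromOrthogonalSpanSingleton
        n (ne_zero_of_mem_unit_sphere (-v))).repr
  have h : ContDiffOn ℝ ω _ Set.univ := U.contDiff.contDiffOn
  have H₁ := (h.comp_inter contDiffOn_stereoToFun).contMDiffOn
  convert! (H₁.of_le le_top).comp' hf.contMDiffOn using 1
  ext x
  have hfxv : (sphereRetract n x : EuclideanSpace ℝ (Fin (n + 1))) = -↑v ↔
      inner ℝ (sphereRetract n x : EuclideanSpace ℝ (Fin (n + 1))) (-↑v) = 1 := by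
    have hfx : ‖(sphereRetract n x : EuclideanSpace ℝ (Fin (n + 1)))‖ = 1 := by simp
    rw [inner_eq_one_iff_of_norm_eq_one hfx]
    exact norm_eq_of_mem_sphere (-v)
  simp [chartAt, ChartedSpace.chartAt, Subtype.ext_iff, hfxv, real_inner_comm]

theorem mdifferentiableAt_sphereRetract {y : EuclideanSpace ℝ (Fin (n + 1))} (hy : y ≠ 0) :
    MDifferentiableAt 𝓘(ℝ, EuclideanSpace ℝ (Fin (n + 1))) (𝓡 n) (sphereRetract n) y :=
  ((contMDiffOn_sphereRetract n).contMDiffAt (isOpen_compl_singleton.mem_nhds hy)).mdifferentiableAt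
    (by simp)

/-- The radial projection is a retraction, so its differential inverts that of the inclusion. -/
theorem mfderiv_sphereRetract_sphereInclDeriv (x : StdSphere n) (v : TangentSpace (𝓡 n) x) :
    (mfderiv 𝓘(ℝ, EuclideanSpace ℝ (Fin (n + 1))) (𝓡 n) (sphereRetract n)
      (x : EuclideanSpace ℝ (Fin (n + 1))) (sphereInclDeriv n x v) : EuclideanSpace ℝ (Fin n)) =
      v := by
  have h := mfderiv_comp x
    (mdifferentiableAt_sphereRetract (ne_zero_of_mem_unit_sphere x))
    ((contMDiff_coe_stdSphere n x).mdifferentiableAt (by simp))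
  have e : sphereRetract n ∘ ((↑) : StdSphere n → EuclideanSpace ℝ (Fin (n + 1))) = id :=
    funext sphereRetract_coe
  have h' := congr($h v)
  rw [e, mfderiv_id] at h'
  exact h'.symm

/-- The vector field on the sphere whose value at `x` is the tangent vector `A x`, obtained by
means of the radial projection. -/
def tangentField (A : EuclideanSpace ℝ (Fin (n + 1)) → EuclideanSpace ℝ (Fin (n + 1))) :
    VecField n (StdSphere n) :=
  fun x => (mfderiv 𝓘(ℝ, EuclideanSpace ℝ (Fin (n + 1))) (𝓡 n) (sphereRetract n)
      (x : EuclideanSpace ℝ (Fin (n + 1))) (A x) : EuclideanSpace ℝ (Fin n))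

theorem ambientField_tangentField
    {A : EuclideanSpace ℝ (Fin (n + 1)) → EuclideanSpace ℝ (Fin (n + 1))} {x : StdSphere n}
    (hA : inner ℝ (x : EuclideanSpace ℝ (Fin (n + 1))) (A x) = 0) :
    ambientField (tangentField A) x = A x := by
  obtain ⟨v, hv⟩ := exists_sphereInclDeriv_eq x hA
  have : tangentField A x = v := by
    rw [tangentField, ← hv]
    exact mfderiv_sphereRetract_sphereInclDeriv x v
  rw [ambientField, this, hv]


theorem contMDiff_section_along_sphere
    {A : EuclideanSpace ℝ (Fin (n + 1)) → EuclideanSpace ℝ (Fin (n + 1))}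
    (hA : ContDiff ℝ ∞ A) :
    ContMDiff (𝓡 n) 𝓘(ℝ, EuclideanSpace ℝ (Fin (n + 1))).tangent ∞
      (fun x : StdSphere n => (⟨x, A x⟩ : TangentBundle 𝓘(ℝ, EuclideanSpace ℝ (Fin (n + 1)))
        (EuclideanSpace ℝ (Fin (n + 1))))) := by
  have h3 : ContMDiff 𝓘(ℝ, EuclideanSpace ℝ (Fin (n + 1)))
      𝓘(ℝ, EuclideanSpace ℝ (Fin (n + 1))).tangent ∞
      (fun x => (⟨x, A x⟩ : TangentBundle 𝓘(ℝ, EuclideanSpace ℝ (Fin (n + 1)))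
        (EuclideanSpace ℝ (Fin (n + 1))))) :=
    contMDiff_vectorSpace_iff_contDiff.2 hA
  exact h3.comp (contMDiff_coe_stdSphere n)

theorem contMDiffOn_tangentMapWithin_sphereRetract (n : ℕ) :
    ContMDiffOn 𝓘(ℝ, EuclideanSpace ℝ (Fin (n + 1))).tangent (𝓡 n).tangent ∞
      (tangentMapWithin 𝓘(ℝ, EuclideanSpace ℝ (Fin (n + 1))) (𝓡 n) (sphereRetract n) {0}ᶜ)
      (Bundle.TotalSpace.proj ⁻¹' {0}ᶜ) := by
  have : IsManifold (𝓡 n) 1 (StdSphere n) := IsManifold.of_le (n := ∞) (by norm_cast)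
  have hopen : IsOpen ({0}ᶜ : Set (EuclideanSpace ℝ (Fin (n + 1)))) := isOpen_compl_singleton
  exact (contMDiffOn_sphereRetract n).contMDiffOn_tangentMapWithin (m := ∞) (by norm_cast)
    hopen.uniqueMDiffOn

/-- The field `tangentField A` factors through the tangent map of the radial projection, from which
it inherits its smoothness. -/
theorem tangentMapWithin_sphereRetract_eq
    (A : EuclideanSpace ℝ (Fin (n + 1)) → EuclideanSpace ℝ (Fin (n + 1))) (x : StdSphere n) :
    tangentMapWithin 𝓘(ℝ, EuclideanSpace ℝ (Fin (n + 1))) (𝓡 n) (sphereRetract n) {0}ᶜ ⟨x, A x⟩ =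
      ⟨x, tangentField A x⟩ := by
  have hopen : IsOpen ({0}ᶜ : Set (EuclideanSpace ℝ (Fin (n + 1)))) := isOpen_compl_singleton
  have hx : (x : EuclideanSpace ℝ (Fin (n + 1))) ≠ 0 := ne_zero_of_mem_unit_sphere x
  have hu : UniqueMDiffWithinAt 𝓘(ℝ, EuclideanSpace ℝ (Fin (n + 1)))
      ({0}ᶜ : Set (EuclideanSpace ℝ (Fin (n + 1)))) (x : EuclideanSpace ℝ (Fin (n + 1))) :=
    hopen.uniqueMDiffWithinAt hx
  have hw : mfderivWithin 𝓘(ℝ, EuclideanSpace ℝ (Fin (n + 1))) (𝓡 n) (sphereRetract n) {0}ᶜ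
      (x : EuclideanSpace ℝ (Fin (n + 1))) = mfderiv 𝓘(ℝ, EuclideanSpace ℝ (Fin (n + 1))) (𝓡 n)
      (sphereRetract n) (x : EuclideanSpace ℝ (Fin (n + 1))) :=
    mfderivWithin_eq_mfderiv hu (mdifferentiableAt_sphereRetract hx)
  have key : ∀ (y : StdSphere n) (w : TangentSpace (𝓡 n) y) (w' : TangentSpace (𝓡 n) x), y = x →
      (w : EuclideanSpace ℝ (Fin n)) = w' →
      (⟨y, w⟩ : TangentBundle (𝓡 n) (StdSphere n)) = ⟨x, w'⟩ := by
    rintro _ _ _ rfl rfl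
    rfl
  exact key (sphereRetract n x) (mfderivWithin 𝓘(ℝ, EuclideanSpace ℝ (Fin (n + 1))) (𝓡 n)
    (sphereRetract n) {0}ᶜ (x : EuclideanSpace ℝ (Fin (n + 1))) (A x)) (tangentField A x)
    (sphereRetract_coe x) congr($hw (A x))

theorem isSmoothOn_tangentField
    {A : EuclideanSpace ℝ (Fin (n + 1)) → EuclideanSpace ℝ (Fin (n + 1))}
    (hA : ContDiff ℝ ∞ A) (U : Set (StdSphere n)) : IsSmoothOn (tangentField A) U := by
  have h : ContMDiff (𝓡 n) (𝓡 n).tangent ∞ _ :=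
    (contMDiffOn_tangentMapWithin_sphereRetract n).comp_contMDiff
    (contMDiff_section_along_sphere hA) fun x => ne_zero_of_mem_unit_sphere x
  have e : (fun x : StdSphere n =>
      (⟨x, tangentField A x⟩ : TangentBundle (𝓡 n) (StdSphere n))) = _ :=
    (funext (tangentMapWithin_sphereRetract_eq A)).symm
  rw [IsSmoothOn, e]
  exact h.contMDiffOn

theorem MDifferentiableAt.inner_stdSphere
    {f g : StdSphere n → EuclideanSpace ℝ (Fin (n + 1))} {x : StdSphere n}
    (hf : MDifferentiableAt (𝓡 n) 𝓘(ℝ, EuclideanSpace ℝ (Fin (n + 1))) f x)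
    (hg : MDifferentiableAt (𝓡 n) 𝓘(ℝ, EuclideanSpace ℝ (Fin (n + 1))) g x) :
    MDifferentiableAt (𝓡 n) 𝓘(ℝ, ℝ) (fun y => inner ℝ (f y) (g y)) x := by
  have hf' := (mdifferentiableAt_iff _ _).1 hf |>.2
  have hg' := (mdifferentiableAt_iff _ _).1 hg |>.2
  rw [modelWithCornersSelf_coe, range_id, differentiableWithinAt_univ] at hf' hg'
  rw [mdifferentiableAt_iff]
  refine ⟨hf.continuousAt.inner hg.continuousAt, ?_⟩
  rw [modelWithCornersSelf_coe, range_id, differentiableWithinAt_univ]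
  exact hf'.inner ℝ hg'

theorem mvfderiv_inner {f g : StdSphere n → EuclideanSpace ℝ (Fin (n + 1))} {x : StdSphere n}
    (hf : MDifferentiableAt (𝓡 n) 𝓘(ℝ, EuclideanSpace ℝ (Fin (n + 1))) f x)
    (hg : MDifferentiableAt (𝓡 n) 𝓘(ℝ, EuclideanSpace ℝ (Fin (n + 1))) g x)
    (v : TangentSpace (𝓡 n) x) :
    mvfderiv (𝓡 n) (fun y => inner ℝ (f y) (g y)) x v =
      inner ℝ (f x) (mvfderiv (𝓡 n) g x v) + inner ℝ (mvfderiv (𝓡 n) f x v) (g x) := by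
  have hf' := (mdifferentiableAt_iff _ _).1 hf |>.2
  have hg' := (mdifferentiableAt_iff _ _).1 hg |>.2
  rw [modelWithCornersSelf_coe, range_id, differentiableWithinAt_univ] at hf' hg'
  have e := fderiv_inner_apply (𝕜 := ℝ) hf' hg' v
  rw [mvfderiv_eq_fderiv_extChartAt (hf.inner_stdSphere hg), mvfderiv_eq_fderiv_extChartAt hf,
    mvfderiv_eq_fderiv_extChartAt hg]
  refine e.trans ?_
  simp only [writtenInExtChartAt, extChartAt_model_space_eq_id, PartialEquiv.refl_coe,
    Function.comp_apply, id, extChartAt_to_inv]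
  rfl

/-- For the round metric, the expression `L_X g (Y, Z)` only involves the derivative of `X` as a
map to the ambient space. -/
theorem killing_expression_eq {r : ℝ} (hr : 0 < r) {X Y Z : VecField n (StdSphere n)}
    {U : Set (StdSphere n)} (hU : IsOpen U) (hX : IsSmoothOn X U) (hY : IsSmoothOn Y U)
    (hZ : IsSmoothOn Z U) {x : StdSphere n} (hx : x ∈ U) :
    mvfderiv (𝓡 n) (fun y => (roundMetric n r hr).inner y (Y y) (Z y)) x (X x)
      - (roundMetric n r hr).inner x (VectorField.mlieBracket (𝓡 n) X Y x) (Z x)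
      - (roundMetric n r hr).inner x (Y x) (VectorField.mlieBracket (𝓡 n) X Z x) =
    r ^ 2 * (inner ℝ (mvfderiv (𝓡 n) (ambientField X) x (Y x)) (sphereInclDeriv n x (Z x)) +
      inner ℝ (sphereInclDeriv n x (Y x)) (mvfderiv (𝓡 n) (ambientField X) x (Z x))) := by
  have hm : ∀ {W : VecField n (StdSphere n)}, IsSmoothOn W U →
      MDifferentiableAt (𝓡 n) 𝓘(ℝ, EuclideanSpace ℝ (Fin (n + 1))) (ambientField W) x :=
    fun hW => (hW.contMDiffOn_ambientField.contMDiffAt (hU.mem_nhds hx)).mdifferentiableAt (by simp)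
  have hb : ∀ {W : VecField n (StdSphere n)}, IsSmoothOn W U →
      sphereInclDeriv n x (mlieBracket (𝓡 n) X W x) =
      mvfderiv (𝓡 n) (ambientField W) x (X x) - mvfderiv (𝓡 n) (ambientField X) x (W x) :=
    fun hW => mvfderiv_mlieBracket (contMDiff_coe_stdSphere n x) (hX.mdifferentiableAt hU hx)
      (hW.mdifferentiableAt hU hx)
  have hi : ∀ (y : StdSphere n) (v w : TangentSpace (𝓡 n) y), (roundMetric n r hr).inner y v w =
      inner ℝ (r • sphereInclDeriv n y v) (r • sphereInclDeriv n y w) := fun _ _ _ => rfl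
  have hi' : (fun y => (roundMetric n r hr).inner y (Y y) (Z y)) =
      fun y => r ^ 2 * inner ℝ (ambientField Y y) (ambientField Z y) := by
    funext y
    rw [hi, real_inner_smul_left, real_inner_smul_right]
    simp only [ambientField]
    ring
  rw [hi', mvfderiv_fun_mul mdifferentiableAt_const ((hm hY).inner_stdSphere (hm hZ)), hi, hi,
    hb hY, hb hZ]
  simp only [mvfderiv_const, add_apply, smul_apply]
  rw [mvfderiv_inner (hm hY) (hm hZ)]
  simp only [real_inner_smul_left, real_inner_smul_right, inner_sub_left, inner_sub_right,
    ambientField]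
  simp
  ring

end SphereFields

/-! ### Killing fields of round spheres -/

section KillingFields
open VectorField Set Filter Topology Module

attribute [local instance] chartedSpaceSelf

section Flat

variable {E : Type*} [NormedAddCommGroup E] [InnerProductSpace ℝ E]

/-- A trilinear form that is symmetric in the first two and skew in the last two arguments
vanishes; hence the second derivative of a Killing field of a Euclidean space is zero. -/
theorem fderiv_fderiv_eq_zero_of_skew {F : E → E} {p : E} (hF : ContDiffAt ℝ ∞ F p)
    (h : ∀ᶠ y in 𝓝 p, ∀ v, inner ℝ (fderiv ℝ F y v) v = 0) :
    fderiv ℝ (fderiv ℝ F) p = 0 := by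
  have hd : DifferentiableAt ℝ (fderiv ℝ F) p :=
    (hF.fderiv_right (m := 1) (by norm_cast)).differentiableAt one_ne_zero
  have quad : ∀ u v, inner ℝ (fderiv ℝ (fderiv ℝ F) p u v) v = 0 := fun u v => by
    have e : (fun y => inner ℝ (fderiv ℝ F y v) v) =ᶠ[𝓝 p] fun _ => (0 : ℝ) :=
      h.mono fun y hy => hy v
    have e1 := congrArg (fun L : E →L[ℝ] ℝ => L u) e.fderiv_eq
    beta_reduce at e1
    rw [fderiv_inner_apply (𝕜 := ℝ) (hd.clm_apply (differentiableAt_const v))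
      (differentiableAt_const v), fderiv_clm_apply hd (differentiableAt_const v)] at e1
    simpa using e1
  have skew : ∀ u v w, inner ℝ (fderiv ℝ (fderiv ℝ F) p u v) w =
      -inner ℝ (fderiv ℝ (fderiv ℝ F) p u w) v := fun u v w => by
    have := quad u (v + w)
    simp only [map_add, inner_add_left, inner_add_right, quad] at this
    linarith
  have symm : ∀ u v, fderiv ℝ (fderiv ℝ F) p u v = fderiv ℝ (fderiv ℝ F) p v u :=
    fun u v => (hF.isSymmSndFDerivAt (by simp; norm_cast)).eq u v
  ext u v
  refine ext_inner_right ℝ fun w => ?_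
  have h1 := skew u v w
  have h2 := skew w u v
  have h3 := skew v w u
  rw [symm u w] at h1
  rw [symm w v] at h2
  rw [symm v u] at h3
  simp only [zero_apply, inner_zero_left]
  linarith

/-- A quadratic form that vanishes on an open set vanishes identically. -/
theorem inner_self_eq_zero_of_eventually {L : E →L[ℝ] E} {p : E}
    (h : ∀ᶠ y in 𝓝 p, inner ℝ (L y) y = 0) (v : E) : inner ℝ (L v) v = 0 := by
  have h1 : Tendsto (fun t : ℝ => p + t • v) (𝓝 0) (𝓝 p) := by
    have : Continuous fun t : ℝ => p + t • v := by fun_prop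
    simpa using this.tendsto 0
  have h2 : Tendsto (fun t : ℝ => p - t • v) (𝓝 0) (𝓝 p) := by
    have : Continuous fun t : ℝ => p - t • v := by fun_prop
    simpa using this.tendsto 0
  have h3 := ((h1.eventually h).and (h2.eventually h)).filter_mono
    (nhdsWithin_le_nhds (s := {0}ᶜ))
  obtain ⟨t, ⟨ha, hb⟩, ht⟩ := (h3.and self_mem_nhdsWithin).exists
  have h0 := h.self_of_nhds
  simp only [map_add, map_sub, map_smul, inner_add_left, inner_add_right, inner_sub_left,
    inner_sub_right, real_inner_smul_left, real_inner_smul_right, h0] at ha hb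
  have : t * (t * inner ℝ (L v) v) = 0 := by linarith
  have ht0 : t ≠ 0 := ht
  simpa [ht0] using this

end Flat

variable {n : ℕ}

/-- The Killing equation for the ambient form of the field, on the diagonal. It is obtained by
testing with a smooth field that takes the value `v` at `x`. -/
theorem IsKillingOn.inner_mvfderiv_self {r : ℝ} {hr : 0 < r} {X : VecField n (StdSphere n)}
    {U : Set (StdSphere n)} (hU : IsOpen U) (hX : IsKillingOn (roundMetric n r hr) X U)
    {x : StdSphere n} (hx : x ∈ U) (v : TangentSpace (𝓡 n) x) :
    inner ℝ (mvfderiv (𝓡 n) (ambientField X) x v) (sphereInclDeriv n x v) = 0 := by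
  have hs := isSmoothOn_tangentField (n := n) (contDiff_const (c := sphereInclDeriv n x v)) U
  have hv : tangentField (fun _ => sphereInclDeriv n x v) x = v :=
    sphereInclDeriv_injective n x
      (ambientField_tangentField (A := fun _ => sphereInclDeriv n x v) (inner_sphereInclDeriv x v))
  have h := hX.2 _ _ hs hs x hx
  rw [killing_expression_eq hr hU hX.1 hs hs hx, hv,
    real_inner_comm (mvfderiv (𝓡 n) (ambientField X) x v)] at h
  have : r ^ 2 ≠ 0 := by positivity
  simpa [this] using h

/-- Skew-symmetric linear maps restrict to Killing fields. -/
theorem isKilling_tangentField {r : ℝ} (hr : 0 < r)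
    {A : EuclideanSpace ℝ (Fin (n + 1)) →L[ℝ] EuclideanSpace ℝ (Fin (n + 1))}
    (hA : ∀ u v, inner ℝ (A u) v = -inner ℝ u (A v)) :
    IsKilling (roundMetric n r hr) (tangentField A) := by
  have hs : ∀ x, ambientField (tangentField A) x = A x := fun x => by
    refine ambientField_tangentField ?_
    have := hA x x
    rw [real_inner_comm] at this
    linarith
  have hd : ∀ (x : StdSphere n) (v : TangentSpace (𝓡 n) x),
      mvfderiv (𝓡 n) (ambientField (tangentField A)) x v = A (sphereInclDeriv n x v) := by
    intro x v
    have h := mfderiv_comp x (A.differentiableAt (x := (x : EuclideanSpace ℝ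
      (Fin (n + 1))))).mdifferentiableAt
      ((contMDiff_coe_stdSphere n x).mdifferentiableAt (by simp))
    have e : A ∘ ((↑) : StdSphere n → EuclideanSpace ℝ (Fin (n + 1))) =
      ambientField (tangentField A) := funext fun x => (hs x).symm
    rw [e, mfderiv_eq_fderiv, A.fderiv] at h
    exact congr($h v)
  have hsm := isSmoothOn_tangentField (n := n) A.contDiff univ
  refine ⟨hsm, fun Y Z hY hZ x hx => ?_⟩
  rw [killing_expression_eq hr isOpen_univ hsm hY hZ hx, hd, hd, hA]
  simp

/-- Derivative of the homogeneous extension of degree one of a map on the sphere. -/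
theorem fderiv_norm_smul_comp_sphereRetract {G : StdSphere n → EuclideanSpace ℝ (Fin (n + 1))}
    {y : EuclideanSpace ℝ (Fin (n + 1))} (hy : y ≠ 0)
    (hG : MDifferentiableAt (𝓡 n) 𝓘(ℝ, EuclideanSpace ℝ (Fin (n + 1))) G (sphereRetract n y))
    (v : EuclideanSpace ℝ (Fin (n + 1))) :
    fderiv ℝ (fun z => ‖z‖ • G (sphereRetract n z)) y v =
      fderiv ℝ (fun z => ‖z‖) y v • G (sphereRetract n y) +
      ‖y‖ • mvfderiv (𝓡 n) G (sphereRetract n y)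
        (mfderiv 𝓘(ℝ, EuclideanSpace ℝ (Fin (n + 1))) (𝓡 n) (sphereRetract n) y v) := by
  have hn : DifferentiableAt ℝ (fun z : EuclideanSpace ℝ (Fin (n + 1)) => ‖z‖) y :=
    (contDiffAt_norm ℝ hy).differentiableAt one_ne_zero
  have hc := MDifferentiableAt.comp y hG (mdifferentiableAt_sphereRetract hy)
  have h := mfderiv_comp y hG (mdifferentiableAt_sphereRetract hy)
  rw [mfderiv_eq_fderiv] at h
  have hv : fderiv ℝ (fun z => G (sphereRetract n z)) y v =
      mvfderiv (𝓡 n) G (sphereRetract n y)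
        (mfderiv 𝓘(ℝ, EuclideanSpace ℝ (Fin (n + 1))) (𝓡 n) (sphereRetract n) y v) := congr($h v)
  have e := congr($(fderiv_fun_smul hn hc.differentiableAt) v)
  refine e.trans ?_
  simp only [add_apply, smul_apply, ContinuousLinearMap.smulRight_apply]
  refine (add_comm (_ : EuclideanSpace ℝ (Fin (n + 1))) _).trans ?_
  exact congrArg₂ _ rfl (congrArg _ hv)

/-- The derivative of the radial projection, in the ambient space: `y = ‖y‖ • π y` is differentiated
and the radial part is separated. -/
theorem eq_radial_add_tangential {y : EuclideanSpace ℝ (Fin (n + 1))} (hy : y ≠ 0)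
    (v : EuclideanSpace ℝ (Fin (n + 1))) :
    v = fderiv ℝ (fun z => ‖z‖) y v • (sphereRetract n y : EuclideanSpace ℝ (Fin (n + 1))) +
      ‖y‖ • sphereInclDeriv n (sphereRetract n y)
        (mfderiv 𝓘(ℝ, EuclideanSpace ℝ (Fin (n + 1))) (𝓡 n) (sphereRetract n) y v) := by
  have h := fderiv_norm_smul_comp_sphereRetract hy
    ((contMDiff_coe_stdSphere n _).mdifferentiableAt (by simp)) v
  have e : (fun z : EuclideanSpace ℝ (Fin (n + 1)) =>
      ‖z‖ • (sphereRetract n z : EuclideanSpace ℝ (Fin (n + 1)))) = id := by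
    funext z
    rcases eq_or_ne z 0 with rfl | hz
    · simp
    · rw [coe_sphereRetract hz, smul_smul, mul_inv_cancel₀ (norm_ne_zero_iff.2 hz), one_smul, id]
  rw [e, fderiv_id] at h
  exact h

/-- Locally, a Killing field of a round sphere is the restriction of a skew-symmetric linear
vector field. Its homogeneous extension of degree one to a cone is a Killing field of the flat
metric, and these are affine. -/
theorem IsKillingOn.exists_skew_linear {r : ℝ} {hr : 0 < r} {X : VecField n (StdSphere n)}
    {U : Set (StdSphere n)} (hU : IsOpen U) (hX : IsKillingOn (roundMetric n r hr) X U)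
    {p : StdSphere n} (hp : p ∈ U) :
    ∃ A : EuclideanSpace ℝ (Fin (n + 1)) →L[ℝ] EuclideanSpace ℝ (Fin (n + 1)),
      (∀ v, inner ℝ (A v) v = 0) ∧ ∀ᶠ y in 𝓝 (p : EuclideanSpace ℝ (Fin (n + 1))),
        ‖y‖ • ambientField X (sphereRetract n y) = A y := by
  set F : EuclideanSpace ℝ (Fin (n + 1)) → EuclideanSpace ℝ (Fin (n + 1)) :=
    fun y => ‖y‖ • ambientField X (sphereRetract n y) with hF
  set C : Set (EuclideanSpace ℝ (Fin (n + 1))) := {0}ᶜ ∩ sphereRetract n ⁻¹' U with hC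
  have hCo : IsOpen C :=
    (contMDiffOn_sphereRetract n).continuousOn.isOpen_inter_preimage isOpen_compl_singleton hU
  have hpC : (p : EuclideanSpace ℝ (Fin (n + 1))) ∈ C :=
    ⟨ne_zero_of_mem_unit_sphere p, by rwa [mem_preimage, sphereRetract_coe]⟩
  have hsm : ContMDiffOn (𝓡 n) 𝓘(ℝ, EuclideanSpace ℝ (Fin (n + 1))) ∞ (ambientField X) U :=
    hX.1.contMDiffOn_ambientField
  have hFs : ContDiffOn ℝ ∞ F C := by
    have h1 : ContMDiffOn 𝓘(ℝ, EuclideanSpace ℝ (Fin (n + 1)))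
        𝓘(ℝ, EuclideanSpace ℝ (Fin (n + 1))) ∞ (ambientField X ∘ sphereRetract n) C :=
      hsm.comp ((contMDiffOn_sphereRetract n).mono inter_subset_left) inter_subset_right
    exact (contDiffOn_id.norm ℝ fun y hy => hy.1).smul h1.contDiffOn
  have hG : ∀ y ∈ C, MDifferentiableAt (𝓡 n) 𝓘(ℝ, EuclideanSpace ℝ (Fin (n + 1)))
      (ambientField X) (sphereRetract n y) := fun y hy =>
    (hsm.contMDiffAt (hU.mem_nhds hy.2)).mdifferentiableAt (by simp)
  have hskew : ∀ y ∈ C, ∀ v, inner ℝ (fderiv ℝ F y v) v = 0 := by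
    intro y hy v
    have h1 := eq_radial_add_tangential hy.1 v
    have h2 := fderiv_norm_smul_comp_sphereRetract hy.1 (hG y hy) v
    have h3 := hX.inner_mvfderiv_self hU hy.2
      (mfderiv 𝓘(ℝ, EuclideanSpace ℝ (Fin (n + 1))) (𝓡 n) (sphereRetract n) y v)
    -- Differentiating `⟪x, X x⟫ = 0` exchanges the radial part of `dX` for `X` itself.
    have h4 := mvfderiv_inner ((contMDiff_coe_stdSphere n _).mdifferentiableAt (by simp)) (hG y hy)
      (mfderiv 𝓘(ℝ, EuclideanSpace ℝ (Fin (n + 1))) (𝓡 n) (sphereRetract n) y v)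
    have h5 := inner_ambientField X (sphereRetract n y)
    simp only [inner_ambientField] at h4
    rw [mvfderiv_const] at h4
    refine (congrArg₂ (inner ℝ) h2 h1).trans ?_
    change 0 = inner ℝ _ _ + inner ℝ (sphereInclDeriv n _ _) _ at h4
    generalize sphereInclDeriv n (sphereRetract n y) _ = t at h3 h4 ⊢
    generalize mvfderiv (𝓡 n) (ambientField X) (sphereRetract n y) _ = w at h3 h4 ⊢
    simp only [inner_add_left, inner_add_right, real_inner_smul_left, real_inner_smul_right, h3]
    rw [real_inner_comm] at h5
    rw [real_inner_comm w, real_inner_comm (ambientField X (sphereRetract n y)) t] at h4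
    rw [h5, eq_neg_of_add_eq_zero_left h4.symm]
    ring
  -- Euler's relation for a map that is homogeneous of degree one.
  have heuler : ∀ y ∈ C, fderiv ℝ F y y = F y := by
    intro y hy
    have h1 := eq_radial_add_tangential hy.1 y
    have h2 := fderiv_norm_smul_comp_sphereRetract hy.1 (hG y hy) y
    have h3 := inner_sphereInclDeriv (sphereRetract n y)
      (mfderiv 𝓘(ℝ, EuclideanSpace ℝ (Fin (n + 1))) (𝓡 n) (sphereRetract n) y y)
    have hy0 : ‖y‖ ≠ 0 := norm_ne_zero_iff.2 hy.1
    have hc : ‖y‖ • (sphereRetract n y : EuclideanSpace ℝ (Fin (n + 1))) = y := by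
      rw [coe_sphereRetract hy.1, smul_smul, mul_inv_cancel₀ hy0, one_smul]
    have hcc : inner ℝ (sphereRetract n y : EuclideanSpace ℝ (Fin (n + 1)))
      (sphereRetract n y : EuclideanSpace ℝ (Fin (n + 1))) = 1 := by simp
    have h4 : fderiv ℝ (fun z : EuclideanSpace ℝ (Fin (n + 1)) => ‖z‖) y y = ‖y‖ := by
      have := congrArg (inner ℝ (sphereRetract n y : EuclideanSpace ℝ (Fin (n + 1)))) (hc.trans h1)
      rw [inner_add_right, real_inner_smul_right, real_inner_smul_right, real_inner_smul_right, h3,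
        hcc] at this
      linarith
    have h5 : mfderiv 𝓘(ℝ, EuclideanSpace ℝ (Fin (n + 1))) (𝓡 n) (sphereRetract n) y y = 0 := by
      refine sphereInclDeriv_injective n _ ?_
      rw [map_zero]
      rw [h4, hc] at h1
      exact (smul_eq_zero.1 (left_eq_add.1 h1)).resolve_left hy0
    refine h2.trans ?_
    rw [h4, h5, map_zero, smul_zero, add_zero]
  have hzero : ∀ y ∈ C, fderiv ℝ (fderiv ℝ F) y = 0 := fun y hy =>
    fderiv_fderiv_eq_zero_of_skew (hFs.contDiffAt (hCo.mem_nhds hy))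
      (Filter.mem_of_superset (hCo.mem_nhds hy) hskew)
  obtain ⟨ε, hε, hball⟩ := Metric.isOpen_iff.1 hCo _ hpC
  refine ⟨fderiv ℝ F p, hskew _ hpC, ?_⟩
  filter_upwards [Metric.ball_mem_nhds _ hε] with y hy
  have hconst : fderiv ℝ F y = fderiv ℝ F p := by
    refine Metric.isOpen_ball.is_const_of_fderiv_eq_zero (𝕜 := ℝ)
      (convex_ball _ _).isPreconnected (fun z hz => ?_) (fun z hz => hzero z (hball hz)) hy
      (Metric.mem_ball_self hε)
    exact (((hFs.contDiffAt (hCo.mem_nhds (hball hz))).fderiv_right (m := 1)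
      (by norm_cast)).differentiableAt one_ne_zero).differentiableWithinAt
  rw [← hconst, heuler y (hball hy)]

/-- Orthonormal local Killing fields on a round sphere come from anticommuting complex structures
of the ambient space. -/
theorem lt_radonHurwitz_of_orthonormal_killing {r : ℝ} {hr : 0 < r} {d : ℕ}
    {X : Fin d → VecField n (StdSphere n)} {U : Set (StdSphere n)} (hU : IsOpen U)
    (hne : U.Nonempty) (hX : ∀ i, IsKillingOn (roundMetric n r hr) (X i) U)
    (horth : ∀ y ∈ U, ∀ i j, (roundMetric n r hr).inner y (X i y) (X j y) = if i = j then 1 else 0) :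
    d < radonHurwitz (n + 1) := by
  obtain ⟨p, hp⟩ := hne
  choose A hskew hA using fun i => (hX i).exists_skew_linear hU hp
  have hskew' : ∀ i u v, inner ℝ (A i u) v = -inner ℝ u (A i v) := fun i u v => by
    have := hskew i (u + v)
    simp only [map_add, inner_add_left, inner_add_right, hskew] at this
    rw [real_inner_comm (A i v) u]
    linarith
  have hπ : ∀ᶠ y in 𝓝 (p : EuclideanSpace ℝ (Fin (n + 1))), y ≠ 0 ∧ sphereRetract n y ∈ U := by
    have hCo : IsOpen ({0}ᶜ ∩ sphereRetract n ⁻¹' U) :=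
      (contMDiffOn_sphereRetract n).continuousOn.isOpen_inter_preimage isOpen_compl_singleton hU
    exact hCo.mem_nhds ⟨ne_zero_of_mem_unit_sphere p, by rwa [mem_preimage, sphereRetract_coe]⟩
  -- The relation of orthonormality is quadratic, so it spreads from the cone to the whole space.
  have hquad : ∀ i j v, r ^ 2 * inner ℝ (A i v) (A j v) =
      (if i = j then 1 else 0) * inner ℝ v v := by
    intro i j v
    have := inner_self_eq_zero_of_eventually
      (L := -(r ^ 2 • (A j).comp (A i)) - (if i = j then (1 : ℝ) else 0) •
        ContinuousLinearMap.id ℝ (EuclideanSpace ℝ (Fin (n + 1)))) (p := p) (by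
        filter_upwards [hA i, hA j, hπ] with y hi hj hy
        have h := horth _ hy.2 i j
        change inner ℝ (r • ambientField (X i) (sphereRetract n y))
          (r • ambientField (X j) (sphereRetract n y)) = _ at h
        simp only [real_inner_smul_left, real_inner_smul_right] at h
        simp only [sub_apply, neg_apply, smul_apply, ContinuousLinearMap.comp_apply,
          ContinuousLinearMap.id_apply, inner_sub_left, inner_neg_left, real_inner_smul_left,
          hskew' j (A i y)]
        rw [← hi, ← hj, real_inner_smul_left, real_inner_smul_right, ← h,
          real_inner_self_eq_norm_sq]
        ring) v
    simp only [sub_apply, neg_apply, smul_apply, ContinuousLinearMap.comp_apply,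
      ContinuousLinearMap.id_apply, inner_sub_left, inner_neg_left, real_inner_smul_left,
      hskew' j (A i v)] at this
    linarith
  have hpol : ∀ i j v w, r ^ 2 * (inner ℝ (A i v) (A j w) + inner ℝ (A i w) (A j v)) =
      (if i = j then 1 else 0) * (2 * inner ℝ v w) := by
    intro i j v w
    have h1 := hquad i j (v + w)
    have h2 := hquad i j v
    have h3 := hquad i j w
    simp only [map_add, inner_add_left, inner_add_right, real_inner_comm v w] at h1 ⊢
    linarith
  have hrel : ∀ i j, (r • (A i).toLinearMap : Module.End ℝ (EuclideanSpace ℝ (Fin (n + 1)))) *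
      (r • (A j).toLinearMap) + (r • (A j).toLinearMap) * (r • (A i).toLinearMap) =
      (-(2 * if i = j then 1 else 0) : ℝ) • 1 := by
    intro i j
    ext1 v
    refine ext_inner_right ℝ fun w => ?_
    have := hpol i j v w
    simp only [LinearMap.add_apply, Module.End.mul_apply, LinearMap.smul_apply, map_smul,
      ContinuousLinearMap.coe_coe, Module.End.one_apply, inner_add_left, real_inner_smul_left]
    rw [hskew' i (A j v), hskew' j (A i v), real_inner_comm (A i w) (A j v)]
    linarith
  have hanti : IsAnticommuting (fun _ => -1)
      (fun i => (r • (A i).toLinearMap : Module.End ℝ (EuclideanSpace ℝ (Fin (n + 1))))) := by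
    refine ⟨fun i => ?_, fun i j hij => ?_⟩
    · have h := hrel i i
      rw [if_pos rfl, ← two_smul ℝ, mul_one, neg_smul, ← smul_neg] at h
      simpa using smul_right_injective _ (two_ne_zero (α := ℝ)) h
    · have h := hrel i j
      rw [if_neg hij, mul_zero, neg_zero, zero_smul] at h
      exact eq_neg_of_add_eq_zero_left h
  have := IsAnticommuting.lt_radonHurwitz d hanti
  rwa [finrank_euclideanSpace_fin] at this

end KillingFields

/-! ### Clifford-Killing spaces and the Killing property -/

section CliffordKilling
open Set Module

variable {n : ℕ}

/-- The space of skew-symmetric linear vector fields spanned by a skew family. -/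
def skewField {d : ℕ} (T : Fin d → Matrix (Fin (n + 1)) (Fin (n + 1)) ℝ) :
    (Fin d → ℝ) →ₗ[ℝ] VecField n (StdSphere n) where
  toFun c := tangentField (Matrix.toEuclideanCLM (𝕜 := ℝ) (∑ k, c k • T k))
  map_add' c c' := by
    funext x
    simp only [Pi.add_apply, add_smul, Finset.sum_add_distrib, map_add]
    exact map_add _ _ _
  map_smul' a c := by
    funext x
    simp only [Pi.smul_apply, smul_assoc, ← Finset.smul_sum, map_smul]
    exact map_smul _ a _

namespace IsSkewFamily

variable {d : ℕ} {T : Fin d → Matrix (Fin (n + 1)) (Fin (n + 1)) ℝ}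

theorem inner_toEuclideanCLM (hT : IsSkewFamily T) (c : Fin d → ℝ)
    (u v : EuclideanSpace ℝ (Fin (n + 1))) :
    inner ℝ (Matrix.toEuclideanCLM (𝕜 := ℝ) (∑ k, c k • T k) u) v =
      -inner ℝ u (Matrix.toEuclideanCLM (𝕜 := ℝ) (∑ k, c k • T k) v) := by
  have h : star (∑ k, c k • T k) = -∑ k, c k • T k := by
    rw [Matrix.star_eq_conjTranspose, Matrix.conjTranspose_eq_transpose_of_trivial]
    simp [Matrix.transpose_sum, Matrix.transpose_smul, hT.skew]
  have h2 := map_star (Matrix.toEuclideanCLM (n := Fin (n + 1)) (𝕜 := ℝ)) (∑ k, c k • T k)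
  rw [h, map_neg, ContinuousLinearMap.star_eq_adjoint] at h2
  rw [← ContinuousLinearMap.adjoint_inner_right, ← h2, neg_apply, inner_neg_right]

/-- The Clifford relation for linear combinations of the family, polarised. -/
theorem mul_add_mul (hT : IsSkewFamily T) (c c' : Fin d → ℝ) :
    (∑ k, c k • T k) * (∑ k, c' k • T k) + (∑ k, c' k • T k) * (∑ k, c k • T k) =
      (-(2 * ∑ k, c k * c' k)) • (1 : Matrix (Fin (n + 1)) (Fin (n + 1)) ℝ) := by
  have h : ∀ k l, T k * T l + T l * T k = if k = l then (-2 : ℝ) • 1 else 0 := by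
    intro k l
    split_ifs with hkl
    · rw [hkl, hT.sq]; module
    · rw [hT.anti hkl]; simp
  have h1 : (∑ k, c k • T k) * (∑ k, c' k • T k) + (∑ k, c' k • T k) * (∑ k, c k • T k) =
      ∑ k, ∑ l, (c k * c' l) • (T k * T l + T l * T k) := by
    rw [Finset.sum_mul_sum, Finset.sum_mul_sum, Finset.sum_comm (s := Finset.univ)
      (f := fun i j => c' i • T i * c j • T j), ← Finset.sum_add_distrib]
    refine Finset.sum_congr rfl fun k _ => ?_
    rw [← Finset.sum_add_distrib]
    refine Finset.sum_congr rfl fun l _ => ?_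
    rw [smul_mul_smul_comm, smul_mul_smul_comm, mul_comm (c' l), smul_add]
  rw [h1]
  simp only [h, smul_ite, smul_zero, Finset.sum_ite_eq, Finset.mem_univ, if_true, smul_smul,
    ← Finset.sum_smul]
  rw [← Finset.sum_mul]
  congr 1
  ring

theorem inner_skewField (hT : IsSkewFamily T) {r : ℝ} (hr : 0 < r) (c c' : Fin d → ℝ)
    (x : StdSphere n) :
    (roundMetric n r hr).inner x (skewField T c x) (skewField T c' x) =
      r ^ 2 * ∑ k, c k * c' k := by
  have hs : ∀ c : Fin d → ℝ, ambientField (skewField T c) x =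
      Matrix.toEuclideanCLM (𝕜 := ℝ) (∑ k, c k • T k) x := fun c => by
    refine ambientField_tangentField ?_
    have := hT.inner_toEuclideanCLM c x x
    rw [real_inner_comm] at this
    linarith
  set A := Matrix.toEuclideanCLM (𝕜 := ℝ) (∑ k, c k • T k) with hA
  set A' := Matrix.toEuclideanCLM (𝕜 := ℝ) (∑ k, c' k • T k) with hA'
  have hrel : A (A' x) + A' (A x) =
      (-(2 * ∑ k, c k * c' k)) • (x : EuclideanSpace ℝ (Fin (n + 1))) := by
    have := congrArg (Matrix.toEuclideanCLM (𝕜 := ℝ)) (hT.mul_add_mul c c')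
    rw [map_add, map_mul, map_mul, map_smul, map_one] at this
    exact congr($this x)
  have h1 := congrArg (fun v => inner ℝ v (x : EuclideanSpace ℝ (Fin (n + 1)))) hrel
  have hxx : inner ℝ (x : EuclideanSpace ℝ (Fin (n + 1))) (x : EuclideanSpace ℝ (Fin (n + 1))) = 1 := by
    simp
  simp only [inner_add_left, real_inner_smul_left, hxx] at h1
  rw [hT.inner_toEuclideanCLM c (A' x) x, hT.inner_toEuclideanCLM c' (A x) x, ← hA, ← hA',
    real_inner_comm (A x) (A' x)] at h1
  change inner ℝ (r • ambientField (skewField T c) x) (r • ambientField (skewField T c') x) = _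
  rw [hs, hs, ← hA, ← hA', real_inner_smul_left, real_inner_smul_right]
  linear_combination (-(r ^ 2 / 2)) * h1

theorem isKilling_skewField (hT : IsSkewFamily T) {r : ℝ} (hr : 0 < r) (c : Fin d → ℝ) :
    IsKilling (roundMetric n r hr) (skewField T c) :=
  isKilling_tangentField hr (hT.inner_toEuclideanCLM c)

theorem exists_isCliffordKilling (hT : IsSkewFamily T) {r : ℝ} (hr : 0 < r) (hd : d ≠ 0) :
    ∃ V : Submodule ℝ (VecField n (StdSphere n)),
      IsCliffordKilling (roundMetric n r hr) V ∧ finrank ℝ V = d := by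
  have hinj : Function.Injective (skewField T) := by
    rw [← LinearMap.ker_eq_bot, LinearMap.ker_eq_bot']
    intro c hc
    have h := hT.inner_skewField hr c c (sphereRetract n 0)
    rw [hc] at h
    have h0 : r ^ 2 * ∑ k, c k * c k = 0 := by
      rw [← h]
      simp
    have hr2 : r ^ 2 ≠ 0 := by positivity
    have h2 := (mul_eq_zero.1 h0).resolve_left hr2
    rw [Finset.sum_eq_zero_iff_of_nonneg fun k _ => mul_self_nonneg _] at h2
    funext k
    simpa using h2 k (Finset.mem_univ k)
  have hfin : finrank ℝ (LinearMap.range (skewField T)) = d := by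
    rw [LinearMap.finrank_range_of_inj hinj, finrank_fin_fun]
  refine ⟨LinearMap.range (skewField T), ⟨inferInstance, ?_, ?_, ?_⟩, hfin⟩
  · rintro h
    rw [h, finrank_bot] at hfin
    exact hd hfin.symm
  · rintro _ ⟨c, rfl⟩
    exact hT.isKilling_skewField hr c
  · rintro _ ⟨c, rfl⟩
    exact ⟨_, fun x => congrArg Real.sqrt (hT.inner_skewField hr c c x)⟩

theorem hasKillingProperty {T : Fin n → Matrix (Fin (n + 1)) (Fin (n + 1)) ℝ} (hT : IsSkewFamily T)
    {r : ℝ} (hr : 0 < r) : HasKillingProperty (roundMetric n r hr) := by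
  refine fun x => ⟨univ, isOpen_univ, mem_univ x, fun i => skewField T (Pi.single i r⁻¹),
    fun i => hT.isKilling_skewField hr _, fun y _ i j => ?_⟩
  rw [hT.inner_skewField]
  have hr0 : r ≠ 0 := hr.ne'
  split_ifs with h
  · subst h
    simp [Pi.single_apply]
    field_simp
  · simp [Pi.single_apply, Ne.symm h]

end IsSkewFamily

/-- Evaluation at one point is injective on a space of fields of constant length, and by
polarisation the inner products of its members are constant functions. An orthonormal basis at one
point is thus orthonormal everywhere. -/
theorem IsCliffordKilling.finrank_lt {r : ℝ} {hr : 0 < r}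
    {V : Submodule ℝ (VecField n (StdSphere n))} (hV : IsCliffordKilling (roundMetric n r hr) V) :
    finrank ℝ V < radonHurwitz (n + 1) := by
  have := hV.finiteDimensional
  -- `sphereRetract n 0` only serves as some point of the sphere.
  let p : StdSphere n := sphereRetract n 0
  let D : ∀ x : StdSphere n, V →ₗ[ℝ] EuclideanSpace ℝ (Fin (n + 1)) := fun x =>
    { toFun := fun X => r • ambientField X.1 x
      map_add' := fun X Y => by
        rw [← smul_add]
        exact congrArg _ (map_add (sphereInclDeriv n x) _ _)
      map_smul' := fun a X => by
        rw [RingHom.id_apply, smul_comm]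
        exact congrArg _ (map_smul (sphereInclDeriv n x) a _) }
  have hD : ∀ x (X Y : V), (roundMetric n r hr).inner x (X.1 x) (Y.1 x) =
    inner ℝ (D x X) (D x Y) := fun _ _ _ => rfl
  have hself : ∀ x (X : V), inner ℝ (D x X) (D x X) = inner ℝ (D p X) (D p X) := by
    intro x X
    obtain ⟨a, ha⟩ := hV.constantLength X.1 X.2
    have := (ha x).trans (ha p).symm
    rw [hD, hD] at this
    exact (Real.sqrt_inj real_inner_self_nonneg real_inner_self_nonneg).1 this
  have hpol : ∀ x (X Y : V), inner ℝ (D x X) (D x Y) = inner ℝ (D p X) (D p Y) := by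
    intro x X Y
    have h := hself x (X + Y)
    simp only [map_add, inner_add_left, inner_add_right, hself x X, hself x Y,
      real_inner_comm (D _ X) (D _ Y)] at h
    linarith
  have hinj : Function.Injective (D p) := by
    rw [← LinearMap.ker_eq_bot, LinearMap.ker_eq_bot']
    intro X hX
    ext1
    funext x
    have h := hself x X
    rw [hX, inner_zero_left, inner_self_eq_zero] at h
    have h' := (smul_eq_zero.1 h).resolve_left hr.ne'
    exact sphereInclDeriv_injective n x (h'.trans (map_zero _).symm)
  let b := stdOrthonormalBasis ℝ (LinearMap.range (D p))
  have hfin : finrank ℝ (LinearMap.range (D p)) = finrank ℝ V := LinearMap.finrank_range_of_inj hinj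
  choose Y hY using fun i => (b i).2
  rw [← hfin]
  refine lt_radonHurwitz_of_orthonormal_killing (hr := hr) (X := fun i => (Y i).1) isOpen_univ
    ⟨p, mem_univ p⟩ (fun i => hV.isKilling _ (Y i).2) fun x _ i j => ?_
  rw [hD, hpol, hY, hY]
  exact orthonormal_iff_ite.1 b.orthonormal i j

theorem isMaxCliffordKillingDim_roundMetric (n : ℕ) (r : ℝ) (hr : 0 < r) :
    IsMaxCliffordKillingDim (roundMetric n r hr) (radonHurwitz (n + 1) - 1) := by
  constructor
  · rcases Nat.eq_zero_or_pos (radonHurwitz (n + 1) - 1) with h | h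
    · exact Or.inl h
    · obtain ⟨T, hT⟩ := exists_isSkewFamily (Nat.succ_ne_zero n)
      exact Or.inr (hT.exists_isCliffordKilling hr h.ne')
  · rintro d (rfl | ⟨V, hV, rfl⟩)
    · exact Nat.zero_le _
    · exact Nat.le_sub_one_of_lt hV.finrank_lt

theorem hasKillingProperty_roundMetric_iff {r : ℝ} (hr : 0 < r) :
    HasKillingProperty (roundMetric n r hr) ↔ radonHurwitz (n + 1) = n + 1 := by
  constructor
  · intro h
    obtain ⟨U, hU, hx, X, hX, horth⟩ := h (sphereRetract n 0)
    exact le_antisymm (radonHurwitz_le_self (Nat.succ_ne_zero n))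
      (lt_radonHurwitz_of_orthonormal_killing hU ⟨_, hx⟩ hX horth)
  · intro h
    have hex := exists_isSkewFamily (Nat.succ_ne_zero n)
    rw [Nat.succ_eq_add_one, h, Nat.add_sub_cancel] at hex
    obtain ⟨T, hT⟩ := hex
    exact hT.hasKillingProperty hr

end CliffordKilling

end

theorem theorem14 (n : ℕ) (r : ℝ) (hr : 0 < r) :
    IsMaxCliffordKillingDim (roundMetric n r hr) (radonHurwitz (n + 1) - 1) ∧
    ((0 < n ∧ IsMaxCliffordKillingDim (roundMetric n r hr) n) ↔
      (n + 1 = 2 ∨ n + 1 = 4 ∨ n + 1 = 8)) ∧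
    (0 < n → (HasKillingProperty (roundMetric n r hr) ↔ (n = 1 ∨ n = 3 ∨ n = 7))) := by
  have hmax := isMaxCliffordKillingDim_roundMetric n r hr
  have hiff := radonHurwitz_eq_self_iff (Nat.succ_ne_zero n)
  rw [Nat.succ_eq_add_one] at hiff
  have hpos := radonHurwitz_pos (n + 1)
  refine ⟨hmax, ⟨fun ⟨hn, h⟩ => ?_, fun h => ?_⟩, fun hn => ?_⟩
  · have := hmax.unique h
    have := hiff.1 (by omega)
    omega
  · have h1 := hiff.2 (Or.inr h)
    refine ⟨by omega, ?_⟩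
    rwa [h1, Nat.add_sub_cancel] at hmax
  · rw [hasKillingProperty_roundMetric_iff, hiff]
    omega
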